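/- Let $m\ge 1$ and let $P(x,u)$ be a symmetric $m\times m$ matrix whose entries are real polynomials in $x\in\mathbb R^n$, $u\in\mathbb R^p$. Let $a_1,\dots,a_{n_a}\in\mathbb R[u]$, $b_1,\dots,b_{n_b}\in\mathbb R[x]$, $a_0:=1$, $\mathbf U=\{u: a_i(u)\ge 0,\ i=1,\dots,n_a\}$ and $\mathbf B=\{x: b_j(x)\ge 0,\ j=1,\dots,n_b\}$. Assume that some $a_{i}$ equals $R_1^2-u^Tu$ and some $b_{j}$ equals $R_2^2-x^Tx$ (so that $\mathbf U$, $\mathbf B$ are compact), and that $\mathbf U$ and $\mathbf B$ have nonempty interior. Put $\lambda(x)=\min\{v^TP(x,u)v : u\in\mathbf U,\ v\in\mathbb R^m,\ v^Tv=1\}$, and let $d_0\in\mathbb N$ satisfy $2d_0\ge\max(2+\deg P,\max_i\deg a_i,\max_j\deg b_j)$. Let $d\ge d_0$. SOS problem. Given natural numbers $d_r$, $d_{s_i}$ $(0\le i\le n_a)$, $d_{t_j}$ $(1\le j\le n_b)$, maximize $\int_{\mathbf B} g(x)\,dx$ over $g\in\mathbb R[x]$ of degree at most $2d$ for which there are a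 polynomial $r\in\mathbb R[x,u,v]$ of degree at most $2d_r$ and sums of squares $s_i,t_j\in\mathbb R[x,u,v]$ of degrees at most $2d_{s_i}$, $2d_{t_j}$ with $$v^TP(x,u)v-g(x)=r\,(1-v^Tv)+\sum_{i=0}^{n_a}s_i\,a_i(u)+\sum_{j=1}^{n_b}t_j\,b_j(x);$$ set $\rho_d=\int_{\mathbf B}\lambda\,dx-\sup_g\int_{\mathbf B}g\,dx$. The lowest degrees are $d_r=d-1$, $d_{s_i}=d-\lceil\deg a_i/2\rceil$, $d_{t_j}=d-\lceil \deg b_j/2\rceil$. A choice of degrees is admissible if each is at least the lowest one and $2d_r+2\ge 2d_{s_i}+\deg a_i$ and $2d_r+2\ge 2d_{t_j}+\deg b_j$ for all $i,j$. Moment problem. For real sequences $y=(y_\gamma)$, $\gamma\in\mathbb N^{n+p+m}$, $|\gamma|\le 2d$, let $L_y$ be the linear functional sending the monomial of exponent $\gamma$ to $y_\gamma$, and let $M_k(h\,y)$ be the matrix with entries $L_y(h\,z^{\alpha+\beta})$, $|\alpha|,|\beta|\le k$, $z=(x,u,v)$. Minimize $L_y(v^TPv)$ subject to $M_d(y)\succeq0$,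 $M_{d-1}((1-v^Tv)y)=0$, $M_{d-\lceil\deg a_i/2\rceil}(a_i\,y)\succeq 0$, $M_{d-\lceil\deg b_j/2\rceil}(b_j\,y)\succeq 0$ for $1\le i\le n_a$, $1\le j\le n_b$, and $L_y(x^\alpha)=\int_{\mathbf B}x^\alpha dx$ for all $\alpha\in\mathbb N^n$ with $|\alpha|\le 2d$; set $\rho_d^*=\int_{\mathbf B}\lambda\,dx-\inf_y L_y(v^TPv)$. Then $\lambda$ is integrable on $\mathbf B$, and for every admissible choice of degrees the SOS problem has an optimal solution $g_d$ (of degree at most $2d$), and every optimal solution $g_d$ satisfies $$\rho_d=\int_{\mathbf B}(\lambda(x)-g_d(x))\,dx=\int_{\mathbf B}|\lambda(x)-g_d(x)|\,dx=\|\lambda-g_d\|_1 .$$ The lowest degrees are admissible; for them, the moment problem also has an optimal solution and there is no duality gap: $\rho_d=\rho_d^*$. -/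

import Mathlib

open MvPolynomial MeasureTheory
open scoped Matrix

/-- The data of a parametrized polynomial matrix inequality: an `m × m` polynomial matrix
`P(x,u)`, polynomials `a i` in `u ∈ ℝ^p` and polynomials `b j` in `x ∈ ℝ^n`. -/
structure PMIData (n p m na nb : ℕ) where
  /-- the polynomial matrix `P(x,u)` -/
  P : Matrix (Fin m) (Fin m) (MvPolynomial (Fin n ⊕ Fin p) ℝ)
  /-- the polynomials describing the uncertainty set -/
  a : Fin na → MvPolynomial (Fin p) ℝ
  /-- the polynomials describing the bounding set -/
  b : Fin nb → MvPolynomial (Fin n) ℝ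

/-- The maximal numbers (half-degrees) bounding the degrees of the unknown polynomials:
`deg r ≤ 2 * r`, `deg s₀ ≤ 2 * s₀`, `deg (s i) ≤ 2 * s i`, `deg (t j) ≤ 2 * t j`. -/
structure SOSDegrees (na nb : ℕ) where
  /-- half-degree of the multiplier of `1 - vᵀv` -/
  r : ℕ
  /-- half-degree of the SOS multiplier of the constant polynomial `a₀ = 1` -/
  s₀ : ℕ
  /-- half-degrees of the SOS multipliers of the `a i` -/
  s : Fin na → ℕ
  /-- half-degrees of the SOS multipliers of the `b j` -/
  t : Fin nb → ℕ

/-- `⌈deg h / 2⌉`. -/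
def halfDegree {σ : Type*} (h : MvPolynomial σ ℝ) : ℕ := (h.totalDegree + 1) / 2

/-- The polynomial `R² - zᵀz`. -/
noncomputable def ballPoly (k : ℕ) (R : ℝ) : MvPolynomial (Fin k) ℝ :=
  C (R ^ 2) - ∑ i, X i ^ 2

/-- Membership in `Σ[z]_k`: sums of squares of degree at most `2k`. -/
def IsSOSOfDegree {σ : Type*} (k : ℕ) (s : MvPolynomial σ ℝ) : Prop :=
  IsSumSq s ∧ s.totalDegree ≤ 2 * k

/-- The Riesz functional `L_y(f) = ∑ f_α y_α` of a sequence `y`. -/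
noncomputable def rieszFunctional {σ : Type*} (y : (σ →₀ ℕ) → ℝ) (f : MvPolynomial σ ℝ) : ℝ :=
  ∑ α ∈ f.support, f.coeff α * y α

/-- The localizing matrix `M_k(h y)`, with rows and columns indexed by the exponents of degree at
most `k` and entries `L_y(h z^(α+β))`. The moment matrix `M_k(y)` is the case `h = 1`. -/
noncomputable def localizingMatrix {σ : Type*} (k : ℕ) (h : MvPolynomial σ ℝ)
    (y : (σ →₀ ℕ) → ℝ) : Matrix {α : σ →₀ ℕ // α.degree ≤ k} {α : σ →₀ ℕ // α.degree ≤ k} ℝ :=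
  fun α β => rieszFunctional y (h * monomial (α.1 + β.1) 1)

namespace PMIData

variable {n p m na nb : ℕ} (D : PMIData n p m na nb)

/-- `U = {u : a i (u) ≥ 0 for all i}`. -/
def U : Set (Fin p → ℝ) := {u | ∀ i, 0 ≤ eval u (D.a i)}

/-- `B = {x : b j (x) ≥ 0 for all j}`. -/
def B : Set (Fin n → ℝ) := {x | ∀ j, 0 ≤ eval x (D.b j)}

/-- `deg P`, the largest degree of an entry. -/
def degP : ℕ := Finset.univ.sup fun k : Fin m × Fin m => (D.P k.1 k.2).totalDegree

/-- The robust minimum eigenvalue function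
`x ↦ min {vᵀ P(x,u) v : u ∈ U, vᵀv = 1}`. -/
noncomputable def robustMinEig (x : Fin n → ℝ) : ℝ :=
  sInf {c | ∃ u ∈ D.U, ∃ v : Fin m → ℝ, v ⬝ᵥ v = 1 ∧
    c = v ⬝ᵥ (D.P.map (eval (Sum.elim x u)) *ᵥ v)}

/-- Polynomials in `x`, seen as polynomials in `(x,u,v)`. -/
noncomputable def ofX (f : MvPolynomial (Fin n) ℝ) : MvPolynomial (Fin n ⊕ Fin p ⊕ Fin m) ℝ :=
  rename Sum.inl f

/-- Polynomials in `u`, seen as polynomials in `(x,u,v)`. -/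
noncomputable def ofU (f : MvPolynomial (Fin p) ℝ) : MvPolynomial (Fin n ⊕ Fin p ⊕ Fin m) ℝ :=
  rename (fun i => Sum.inr (Sum.inl i)) f

/-- The variable `v_k` of `ℝ[x,u,v]`. -/
noncomputable def varV (n p : ℕ) {m : ℕ} (k : Fin m) : MvPolynomial (Fin n ⊕ Fin p ⊕ Fin m) ℝ :=
  X (Sum.inr (Sum.inr k))

/-- The polynomial `1 - vᵀv` of `ℝ[x,u,v]`. -/
noncomputable def sphere (n p m : ℕ) : MvPolynomial (Fin n ⊕ Fin p ⊕ Fin m) ℝ :=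
  1 - ∑ k, varV n p k ^ 2

/-- The polynomial `vᵀ P(x,u) v` of `ℝ[x,u,v]`. -/
noncomputable def quadForm : MvPolynomial (Fin n ⊕ Fin p ⊕ Fin m) ℝ :=
  ∑ k, ∑ l, varV n p k * rename (Sum.map id Sum.inl) (D.P k l) * varV n p l

/-- The lowest possible degrees in the SOS problem of order `d`. -/
def lowestDegrees (d : ℕ) : SOSDegrees na nb where
  r := d - 1
  s₀ := d
  s i := d - halfDegree (D.a i)
  t j := d - halfDegree (D.b j)

/-- Degree choices for the SOS problem of order `d`: at least the lowest ones, and such that `r` is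
allowed a degree for which `r (1 - vᵀv)` has at least the degree of every other product. -/
structure Admissible (d : ℕ) (e : SOSDegrees na nb) : Prop where
  r_ge : (D.lowestDegrees d).r ≤ e.r
  s₀_ge : (D.lowestDegrees d).s₀ ≤ e.s₀
  s_ge : ∀ i, (D.lowestDegrees d).s i ≤ e.s i
  t_ge : ∀ j, (D.lowestDegrees d).t j ≤ e.t j
  s₀_le : 2 * e.s₀ ≤ 2 * e.r + 2
  s_le : ∀ i, 2 * e.s i + (D.a i).totalDegree ≤ 2 * e.r + 2
  t_le : ∀ j, 2 * e.t j + (D.b j).totalDegree ≤ 2 * e.r + 2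

/-- `g` is (the first component of) a feasible point of the SOS problem of order `d`. -/
def SOSFeasible (d : ℕ) (e : SOSDegrees na nb) (g : MvPolynomial (Fin n) ℝ) : Prop :=
  g.totalDegree ≤ 2 * d ∧
  ∃ (r s₀ : MvPolynomial (Fin n ⊕ Fin p ⊕ Fin m) ℝ)
    (s : Fin na → MvPolynomial (Fin n ⊕ Fin p ⊕ Fin m) ℝ)
    (t : Fin nb → MvPolynomial (Fin n ⊕ Fin p ⊕ Fin m) ℝ),
    r.totalDegree ≤ 2 * e.r ∧ IsSOSOfDegree e.s₀ s₀ ∧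
    (∀ i, IsSOSOfDegree (e.s i) (s i)) ∧ (∀ j, IsSOSOfDegree (e.t j) (t j)) ∧
    D.quadForm - ofX g =
      r * sphere n p m + (s₀ + ∑ i, s i * ofU (D.a i)) + ∑ j, t j * ofX (D.b j)

/-- The objective `∫_B g(x) dx`. -/
noncomputable def objective (g : MvPolynomial (Fin n) ℝ) : ℝ := ∫ x in D.B, eval x g

/-- `g` is an optimal solution of the SOS problem: it maximizes `∫_B g` among feasible points. -/
def SOSOptimal (d : ℕ) (e : SOSDegrees na nb) (g : MvPolynomial (Fin n) ℝ) : Prop :=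
  D.SOSFeasible d e g ∧ ∀ g', D.SOSFeasible d e g' → D.objective g' ≤ D.objective g

/-- `ρ_d = ∫_B λ - max ∫_B g`. -/
noncomputable def sosValue (d : ℕ) (e : SOSDegrees na nb) : ℝ :=
  (∫ x in D.B, D.robustMinEig x) - sSup {c | ∃ g, D.SOSFeasible d e g ∧ c = D.objective g}

/-- `y` is feasible for the moment problem of order `d`. Only the entries `y_γ` with
`|γ| ≤ 2d` enter the constraints and the objective. -/
structure MomentFeasible (d : ℕ) (y : (Fin n ⊕ Fin p ⊕ Fin m →₀ ℕ) → ℝ) : Prop where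
  moment : (localizingMatrix d 1 y).PosSemidef
  sphere : localizingMatrix (d - 1) (sphere n p m) y = 0
  loc_a : ∀ i, (localizingMatrix (d - halfDegree (D.a i)) (ofU (D.a i)) y).PosSemidef
  loc_b : ∀ j, (localizingMatrix (d - halfDegree (D.b j)) (ofX (D.b j)) y).PosSemidef
  marginal : ∀ α : Fin n →₀ ℕ, α.degree ≤ 2 * d →
    rieszFunctional y (ofX (monomial α 1)) = ∫ x in D.B, ∏ i, x i ^ α i

/-- `y` is an optimal solution of the moment problem: it minimizes `L_y(vᵀ P v)`. -/
def MomentOptimal (d : ℕ) (y : (Fin n ⊕ Fin p ⊕ Fin m →₀ ℕ) → ℝ) : Prop :=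
  D.MomentFeasible d y ∧ ∀ y', D.MomentFeasible d y' →
    rieszFunctional y D.quadForm ≤ rieszFunctional y' D.quadForm

/-- `ρ*_d = ∫_B λ - min L_y(vᵀ P v)`. -/
noncomputable def momentValue (d : ℕ) : ℝ :=
  (∫ x in D.B, D.robustMinEig x) -
    sInf {c | ∃ y, D.MomentFeasible d y ∧ c = rieszFunctional y D.quadForm}

end PMIData

/-! Write f = vᵀPv and K = B × U × S^(m-1). Feasibility of g says that f - g lies in a truncated
quadratic module, whose elements are nonnegative on K. Hence g ≤ λ on B, which turns the gap between
the integrals into an L¹ norm; λ is continuous because it is an infimum of a continuous function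
over a compact fiber.

Attainment in the SOS problem is a compactness argument in C(K). Restriction to K kills the sphere
multiple and sends the SOS part into a cone generated by the restrictions of q²w, where w runs
through 1, the a i and the b j, and q|K has norm 1. These generators form a compact set in a
finite-dimensional space. Integrating over B at a fixed (u,v) is nonnegative on them, and
`exists_fiberIntegral_pos` shows that no generator is killed by all these functionals; so a finite
sum ℓ of them is positive on every generator and the slices ℓ ≤ M of the cone are compact
(`isCompact_hull_inter_le`). On polynomials in x, ℓ is a positive multiple of ∫_B, so minimizing ℓ(f
- g) maximizes ∫_B g. To return from functions to polynomials, `sphere_dvd` shows that a polynomial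
vanishing on K is a multiple of 1 - vᵀv, and admissibility provides exactly the degree that the
quotient needs.

Feasibility and duality rest on a degree-bounded Archimedean property
(`exists_add_mem_truncModule`): for every w of degree at most 2d, some N + w lies in the module with
the lowest degrees. Constants are thus order units, and the M. Riesz extension theorem extends g ↦
∫_B g to a functional that is nonnegative on the module and whose value at f is at most the SOS
optimum. This is an optimal moment sequence without gap. -/

/-! ### Convex geometry: compact hulls and compact slices of cones -/

theorem Function.Embedding.sum_univ_eq_of_support {ι κ G : Type*} [Fintype ι] [Fintype κ]
    [AddCommMonoid G] (φ : ι ↪ κ) (f : ι → G) (g : κ → G) (hg : ∀ i, g (φ i) = f i)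
    (h0 : ∀ k, k ∉ Set.range φ → g k = 0) : ∑ k, g k = ∑ i, f i := by
  rw [← Finset.sum_subset (Finset.subset_univ (Finset.univ.map φ))]
  · simp [hg]
  · intro k _ hk
    exact h0 k (by simpa using hk)

/-- In finite dimension the convex hull of a compact set is compact. -/
theorem IsCompact.convexHull_of_finiteDimensional {E : Type*} [NormedAddCommGroup E]
    [NormedSpace ℝ E] [FiniteDimensional ℝ E] {S : Set E} (hS : IsCompact S) :
    IsCompact (convexHull ℝ S) := by
  classical
  rcases S.eq_empty_or_nonempty with rfl | ⟨x₀, hx₀⟩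
  · simp
  -- Carathéodory: N points always suffice, so the hull is a continuous image of a simplex times
  -- S^N.
  set N := Module.finrank ℝ E + 1
  have himage : convexHull ℝ S =
      (fun q : (Fin N → ℝ) × (Fin N → E) => ∑ i, q.1 i • q.2 i) ''
        (stdSimplex ℝ (Fin N) ×ˢ Set.pi Set.univ fun _ => S) := by
    apply Set.Subset.antisymm
    · intro x hx
      obtain ⟨ι, _, z, w, hz, hind, hw, hw1, rfl⟩ := eq_pos_convex_span_of_mem_convexHull hx
      have hcard : Fintype.card ι ≤ Fintype.card (Fin N) := by
        rw [Fintype.card_fin]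
        exact hind.card_le_finrank_succ.trans (by
          have := Submodule.finrank_le (vectorSpan ℝ (Set.range z))
          omega)
      obtain ⟨φ⟩ := Function.Embedding.nonempty_of_card_le hcard
      -- A shorter combination is padded with weight 0 at the dummy point x₀.
      refine ⟨(Function.extend φ w 0, Function.extend φ z fun _ => x₀), ⟨⟨?_, ?_⟩, ?_⟩, ?_⟩
      · intro k
        by_cases hk : k ∈ Set.range φ
        · obtain ⟨i, rfl⟩ := hk
          simpa [φ.injective.extend_apply] using (hw i).le
        · simp [Function.extend_apply' _ _ _ hk]
      · rw [← hw1]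
        exact φ.sum_univ_eq_of_support _ _ (fun i => φ.injective.extend_apply _ _ _)
          (fun k hk => by simp [Function.extend_apply' _ _ _ hk])
      · intro k _
        by_cases hk : k ∈ Set.range φ
        · obtain ⟨i, rfl⟩ := hk
          simpa [φ.injective.extend_apply] using hz ⟨i, rfl⟩
        · simpa [Function.extend_apply' _ _ _ hk] using hx₀
      · exact φ.sum_univ_eq_of_support _ _ (fun i => by simp [φ.injective.extend_apply])
          (fun k hk => by simp [Function.extend_apply' _ _ _ hk])
    · rintro _ ⟨⟨w, z⟩, ⟨⟨hw, hw1⟩, hz⟩, rfl⟩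
      exact (convex_convexHull ℝ S).sum_mem (fun i _ => hw i) hw1
        (fun i _ => subset_convexHull ℝ S (hz i trivial))
  rw [himage]
  exact ((isCompact_stdSimplex ℝ (Fin N)).prod (isCompact_univ_pi fun _ => hS)).image
    (by fun_prop)

/-- Needed because the ambient space will be C(K), of which only a finite-dimensional subspace
matters. -/
theorem IsCompact.convexHull_of_subset_submodule {E : Type*} [NormedAddCommGroup E]
    [NormedSpace ℝ E] {F : Submodule ℝ E} [FiniteDimensional ℝ F] {S : Set E}
    (hS : IsCompact S) (hF : S ⊆ F) : IsCompact (convexHull ℝ S) := by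
  have himage : F.subtype '' (F.subtype ⁻¹' S) = S := by
    rw [Set.image_preimage_eq_inter_range]
    simpa using hF
  have hpre : IsCompact (F.subtype ⁻¹' S) := by
    have : Topology.IsInducing F.subtype := Topology.IsInducing.subtypeVal
    rw [this.isCompact_iff, himage]
    exact hS
  have := hpre.convexHull_of_finiteDimensional.image (f := F.subtype) continuous_subtype_val
  rwa [F.subtype.image_convexHull, himage] at this

/-- The slices of the cone generated by a compact set on which a functional is positive. -/
theorem isCompact_hull_inter_le {E : Type*} [NormedAddCommGroup E]
    [NormedSpace ℝ E] {F : Submodule ℝ E} [FiniteDimensional ℝ F] {S : Set E}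
    (hS : IsCompact S) (hF : S ⊆ F) (ℓ : E →L[ℝ] ℝ) (hℓ : ∀ s ∈ S, 0 < ℓ s) (M : ℝ) :
    IsCompact {c | c ∈ PointedCone.hull ℝ S ∧ ℓ c ≤ M} := by
  -- Generators are rescaled to the hyperplane ℓ = 1; the hull T of the result is a compact base of
  -- the cone.
  set S₁ := (fun s => (ℓ s)⁻¹ • s) '' S with hS₁
  have hS₁c : IsCompact S₁ :=
    hS.image_of_continuousOn ((ℓ.continuous.continuousOn.inv₀ fun s hs => (hℓ s hs).ne').smul
      continuousOn_id)
  have hS₁F : S₁ ⊆ F := by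
    rintro _ ⟨s, hs, rfl⟩
    exact F.smul_mem _ (hF hs)
  set T := convexHull ℝ S₁
  have hT : IsCompact T := hS₁c.convexHull_of_subset_submodule hS₁F
  have hℓT : ∀ x ∈ T, ℓ x = 1 := by
    have : T ⊆ {x | ℓ x = 1} := by
      refine convexHull_min ?_ (convex_hyperplane ℓ.toLinearMap.isLinear 1)
      rintro _ ⟨s, hs, rfl⟩
      simp [(hℓ s hs).ne']
    exact this
  have hThull : ∀ x ∈ T, x ∈ PointedCone.hull ℝ S := by
    refine convexHull_min ?_ (PointedCone.hull ℝ S).convex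
    rintro _ ⟨s, hs, rfl⟩
    exact (PointedCone.hull ℝ S).smul_mem (inv_pos.2 (hℓ s hs)).le
      (PointedCone.subset_hull hs)
  have hrep : ∀ c ∈ PointedCone.hull ℝ S, c = 0 ∨ ∃ t : ℝ, 0 < t ∧ ∃ x ∈ T, c = t • x := by
    intro c hc
    induction hc using Submodule.span_induction with
    | mem s hs =>
      refine .inr ⟨ℓ s, hℓ s hs, (ℓ s)⁻¹ • s, subset_convexHull ℝ _ ⟨s, hs, rfl⟩, ?_⟩
      rw [smul_smul, mul_inv_cancel₀ (hℓ s hs).ne', one_smul]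
    | zero => exact .inl rfl
    | add a b _ _ ha hb =>
      rcases ha with rfl | ⟨t, ht, x, hx, rfl⟩
      · simpa using hb
      rcases hb with rfl | ⟨u, hu, y, hy, rfl⟩
      · exact .inr ⟨t, ht, x, hx, by simp⟩
      · refine .inr ⟨t + u, by positivity, (t / (t + u)) • x + (u / (t + u)) • y,
          convex_convexHull ℝ S₁ hx hy (by positivity) (by positivity) (by field_simp), ?_⟩
        rw [smul_add, smul_smul, smul_smul]
        congr 2 <;> field_simp
    | smul r a _ ha =>
      rcases ha with rfl | ⟨t, ht, x, hx, rfl⟩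
      · simp
      rcases r.2.eq_or_lt with hr | hr
      · left
        have : r = 0 := Subtype.ext hr.symm
        simp [this]
      · exact .inr ⟨r.1 * t, mul_pos hr ht, x, hx, by rw [mul_smul]; rfl⟩
  -- The origin is listed separately because T may be empty.
  have heq : {c | c ∈ PointedCone.hull ℝ S ∧ ℓ c ≤ M} =
      ({c | c = 0 ∧ (0 : ℝ) ≤ M} : Set E) ∪
        (fun q : ℝ × E => q.1 • q.2) '' (Set.Icc 0 M ×ˢ T) := by
    ext c
    constructor
    · rintro ⟨hc, hM⟩
      rcases hrep c hc with rfl | ⟨t, ht, x, hx, rfl⟩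
      · exact .inl ⟨rfl, by simpa using hM⟩
      · exact .inr ⟨(t, x), ⟨⟨ht.le, by simpa [hℓT x hx] using hM⟩, hx⟩, rfl⟩
    · rintro (⟨rfl, hM⟩ | ⟨⟨t, x⟩, ⟨⟨ht, htM⟩, hx⟩, rfl⟩)
      · exact ⟨zero_mem _, by simpa using hM⟩
      · exact ⟨(PointedCone.hull ℝ S).smul_mem ht (hThull x hx),
          by simpa [hℓT x hx] using htM⟩
  rw [heq]
  refine IsCompact.union ?_ ((isCompact_Icc.prod hT).image (by fun_prop))
  exact (Set.finite_singleton (0 : E)).subset (fun c hc => hc.1) |>.isCompact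

/-- Functionals that are nonnegative on a compact set, and not all zero at any of its points,
have a finite sum that is positive on it. -/
theorem exists_finset_sum_pos {E : Type*} [NormedAddCommGroup E]
    [NormedSpace ℝ E] {S : Set E} (hS : IsCompact S) {ι : Type*} [Nonempty ι]
    (ℓ : ι → E →L[ℝ] ℝ) (h0 : ∀ i, ∀ s ∈ S, 0 ≤ ℓ i s) (hpos : ∀ s ∈ S, ∃ i, 0 < ℓ i s) :
    ∃ I : Finset ι, I.Nonempty ∧ ∀ s ∈ S, 0 < ∑ i ∈ I, ℓ i s := by
  classical
  obtain ⟨J, hJ⟩ := hS.elim_finite_subcover (fun i => {s | 0 < ℓ i s})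
    (fun i => isOpen_lt continuous_const (ℓ i).continuous)
    (fun s hs => Set.mem_iUnion.2 (hpos s hs))
  -- The extra index keeps the family nonempty even if S is empty; the number of indices is later
  -- divided out.
  refine ⟨insert (Classical.arbitrary ι) J, Finset.insert_nonempty _ _, fun s hs => ?_⟩
  obtain ⟨i, hi, hs'⟩ := Set.mem_iUnion₂.1 (hJ hs)
  exact Finset.sum_pos' (fun j _ => h0 j s hs) ⟨i, Finset.mem_insert_of_mem hi, hs'⟩

/-! ### Degrees of nonnegative polynomials and of sums of squares -/

namespace MvPolynomial

variable {σ : Type*}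

theorem eq_zero_of_eval_eq_zero_on_isOpen [Fintype σ] {O : Set (σ → ℝ)} (hO : IsOpen O)
    (hne : O.Nonempty) {q : MvPolynomial σ ℝ} (hq : ∀ z ∈ O, eval z q = 0) : q = 0 := by
  obtain ⟨z₀, hz₀⟩ := hne
  obtain ⟨ε, hε, hball⟩ := Metric.isOpen_iff.1 hO z₀ hz₀
  refine funext_set (fun i => Metric.ball (z₀ i) ε) (fun i => ?_) fun z hz => ?_
  · rw [Real.ball_eq_Ioo]
    exact Set.Ioo_infinite (by linarith)
  · rw [map_zero]
    refine hq z (hball ?_)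
    rw [ball_pi _ hε]
    exact hz

theorem IsHomogeneous.eval_smul_real {q : MvPolynomial σ ℝ} {N : ℕ} (hq : q.IsHomogeneous N)
    (t : ℝ) (z : σ → ℝ) : eval (t • z) q = t ^ N * eval z q := by
  rw [eval_eq, eval_eq, Finset.mul_sum]
  refine Finset.sum_congr rfl fun γ hγ => ?_
  have hdeg : ∑ i ∈ γ.support, γ i = N := by
    have := hq (mem_support_iff.1 hγ)
    rw [Finsupp.weight_apply] at this
    simpa [Finsupp.sum] using this
  simp only [Pi.smul_apply, smul_eq_mul, mul_pow, Finset.prod_mul_distrib]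
  rw [Finset.prod_pow_eq_pow_sum, hdeg]
  ring

theorem eval_smul_eq_sum {q : MvPolynomial σ ℝ} {N : ℕ} (hN : q.totalDegree ≤ N) (t : ℝ)
    (z : σ → ℝ) :
    eval (t • z) q = ∑ i ∈ Finset.range (N + 1), t ^ i * eval z (homogeneousComponent i q) := by
  have hsum : q = ∑ i ∈ Finset.range (N + 1), homogeneousComponent i q := by
    conv_lhs => rw [← sum_homogeneousComponent q]
    refine Finset.sum_subset (Finset.range_mono (by omega)) fun i _ hi => ?_
    exact homogeneousComponent_eq_zero _ _ (by simpa using hi)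
  conv_lhs => rw [hsum, map_sum]
  refine Finset.sum_congr rfl fun i _ => ?_
  exact IsHomogeneous.eval_smul_real (homogeneousComponent_isHomogeneous i q) t z

/-- The top component of a nonnegative polynomial is nonnegative. -/
theorem eval_homogeneousComponent_nonneg {q : MvPolynomial σ ℝ} (hq : ∀ z, 0 ≤ eval z q) {N : ℕ}
    (hN : q.totalDegree ≤ N) (z : σ → ℝ) : 0 ≤ eval z (homogeneousComponent N q) := by
  -- For u > 0 this is u^N q(z/u); its limit at u = 0 is the component of degree N.
  set F : ℝ → ℝ := fun u =>
    ∑ i ∈ Finset.range (N + 1), u ^ (N - i) * eval z (homogeneousComponent i q) with hF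
  have hFc : Continuous F := by fun_prop
  have hFpos : ∀ u, 0 < u → 0 ≤ F u := by
    intro u hu
    have : F u = u ^ N * eval (u⁻¹ • z) q := by
      rw [eval_smul_eq_sum hN, Finset.mul_sum]
      refine Finset.sum_congr rfl fun i hi => ?_
      have hi : i ≤ N := by simpa [Nat.lt_succ_iff] using hi
      rw [← mul_assoc, inv_pow, pow_sub₀ _ hu.ne' hi]
    rw [this]
    exact mul_nonneg (by positivity) (hq _)
  have hF0 : F 0 = eval z (homogeneousComponent N q) := by
    rw [hF]
    simp only
    rw [Finset.sum_eq_single N]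
    · simp
    · intro i hi hne
      have : N - i ≠ 0 := by
        have := Finset.mem_range.1 hi
        omega
      simp [this]
    · simp
  rw [← hF0]
  refine ge_of_tendsto (hFc.continuousAt.tendsto.mono_left nhdsWithin_le_nhds :
    Filter.Tendsto F (nhdsWithin 0 (Set.Ioi 0)) (nhds (F 0))) ?_
  filter_upwards [self_mem_nhdsWithin] with u hu using hFpos u hu

theorem homogeneousComponent_totalDegree_ne_zero {q : MvPolynomial σ ℝ} (hq : q ≠ 0) :
    homogeneousComponent q.totalDegree q ≠ 0 := by
  obtain ⟨γ, hγ, hdeg⟩ := Finset.exists_mem_eq_sup q.support (support_nonempty.2 hq)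
    (fun s => s.sum fun _ e => e)
  have hdeg' : γ.degree = q.totalDegree := hdeg.symm
  intro h
  have := congrArg (coeff γ) h
  rw [coeff_homogeneousComponent, if_pos hdeg', coeff_zero] at this
  exact (mem_support_iff.1 hγ) this

/-- No cancellation of top components in sums of nonnegative polynomials. -/
theorem totalDegree_le_totalDegree_add_of_nonneg {q s : MvPolynomial σ ℝ}
    (hq : ∀ z, 0 ≤ eval z q) (hs : ∀ z, 0 ≤ eval z s) :
    q.totalDegree ≤ (q + s).totalDegree := by
  by_contra! hlt
  set N := max q.totalDegree s.totalDegree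
  have hN : (q + s).totalDegree < N := hlt.trans_le (le_max_left _ _)
  have hzero := homogeneousComponent_eq_zero _ _ hN
  rw [map_add] at hzero
  have heval : ∀ z, eval z (homogeneousComponent N q) = 0 ∧
      eval z (homogeneousComponent N s) = 0 := by
    intro z
    have h1 := eval_homogeneousComponent_nonneg hq (le_max_left _ s.totalDegree) z
    have h2 := eval_homogeneousComponent_nonneg hs (le_max_right q.totalDegree _) z
    have h3 := congrArg (eval z) hzero
    rw [map_add, map_zero] at h3
    constructor <;> linarith
  have hqN : homogeneousComponent N q = 0 := MvPolynomial.funext fun z => by simp [(heval z).1]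
  have hsN : homogeneousComponent N s = 0 := MvPolynomial.funext fun z => by simp [(heval z).2]
  rcases max_choice q.totalDegree s.totalDegree with h | h
  · refine homogeneousComponent_totalDegree_ne_zero (q := q) ?_ (h ▸ hqN)
    rintro rfl
    simp at hlt
  · refine homogeneousComponent_totalDegree_ne_zero (q := s) ?_ (h ▸ hsN)
    rintro rfl
    simp at hlt

theorem eval_nonneg_of_isSumSq {s : MvPolynomial σ ℝ} (hs : IsSumSq s) (z : σ → ℝ) :
    0 ≤ eval z s := by
  induction hs with
  | zero => simp
  | sq_add a _ ih =>
    rw [map_add, map_mul]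
    exact add_nonneg (mul_self_nonneg _) ih

theorem isSumSq_smul {s : MvPolynomial σ ℝ} (hs : IsSumSq s) {c : ℝ} (hc : 0 ≤ c) :
    IsSumSq (c • s) := by
  have : c • s = C (Real.sqrt c) * C (Real.sqrt c) * s := by
    rw [← C_mul, Real.mul_self_sqrt hc, smul_eq_C_mul]
  rw [this]
  exact (IsSumSq.mul_self _).mul hs

theorem totalDegree_mul_self (q : MvPolynomial σ ℝ) :
    (q * q).totalDegree = 2 * q.totalDegree := by
  rcases eq_or_ne q 0 with rfl | hq
  · simp
  · rw [totalDegree_mul_of_isDomain hq hq, two_mul]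

theorem isSOSOfDegree_mul_self {q : MvPolynomial σ ℝ} {k : ℕ} (hq : q.totalDegree ≤ k) :
    IsSOSOfDegree k (q * q) :=
  ⟨IsSumSq.mul_self q, by rw [totalDegree_mul_self]; omega⟩

/-- Leading forms of squares cannot cancel, so a bound 2k on the sum bounds each squared polynomial
by k. This makes the SOS cones accessible through finite-dimensional spaces of q. -/
theorem _root_.IsSOSOfDegree.induction {k : ℕ} {motive : MvPolynomial σ ℝ → Prop}
    (zero : motive 0) (sq_add : ∀ q s, q.totalDegree ≤ k → motive s → motive (q * q + s))
    {s : MvPolynomial σ ℝ} (hs : IsSOSOfDegree k s) : motive s := by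
  obtain ⟨hs, hdeg⟩ := hs
  induction hs with
  | zero => exact zero
  | @sq_add q s hs ih =>
    have hq0 := eval_nonneg_of_isSumSq (IsSumSq.mul_self q)
    have hs0 := eval_nonneg_of_isSumSq hs
    have h1 := totalDegree_le_totalDegree_add_of_nonneg hq0 hs0
    have h2 := totalDegree_le_totalDegree_add_of_nonneg hs0 hq0
    rw [add_comm s] at h2
    rw [totalDegree_mul_self] at h1
    exact sq_add q s (by omega) (ih (by omega))

theorem isSOSOfDegree_zero (k : ℕ) : IsSOSOfDegree k (0 : MvPolynomial σ ℝ) :=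
  ⟨.zero, by simp⟩

theorem _root_.IsSOSOfDegree.add {k : ℕ} {s t : MvPolynomial σ ℝ} (hs : IsSOSOfDegree k s)
    (ht : IsSOSOfDegree k t) : IsSOSOfDegree k (s + t) :=
  ⟨hs.1.add ht.1, (totalDegree_add _ _).trans (max_le hs.2 ht.2)⟩

theorem _root_.IsSOSOfDegree.smul {k : ℕ} {s : MvPolynomial σ ℝ} (hs : IsSOSOfDegree k s)
    {c : ℝ} (hc : 0 ≤ c) : IsSOSOfDegree k (c • s) :=
  ⟨isSumSq_smul hs.1 hc, (totalDegree_smul_le _ _).trans hs.2⟩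

theorem _root_.IsSOSOfDegree.mono {k l : ℕ} (hkl : k ≤ l) {s : MvPolynomial σ ℝ}
    (hs : IsSOSOfDegree k s) : IsSOSOfDegree l s :=
  ⟨hs.1, hs.2.trans (by omega)⟩

/-! ### Divisibility by polynomials of the form c - X i ^ 2 -/

section Divisibility

variable [DecidableEq σ]

/-- The values of `q` do not depend on the variable `i`. -/
def IsIndepOf (i : σ) (q : MvPolynomial σ ℝ) : Prop :=
  ∀ z t, eval (Function.update z i t) q = eval z q

theorem IsIndepOf.add {i : σ} {q s : MvPolynomial σ ℝ} (hq : IsIndepOf i q)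
    (hs : IsIndepOf i s) : IsIndepOf i (q + s) := fun z t => by
  rw [map_add, map_add, hq, hs]

theorem IsIndepOf.mul {i : σ} {q s : MvPolynomial σ ℝ} (hq : IsIndepOf i q)
    (hs : IsIndepOf i s) : IsIndepOf i (q * s) := fun z t => by
  rw [map_mul, map_mul, hq, hs]

theorem isIndepOf_C (i : σ) (c : ℝ) : IsIndepOf i (C c) := fun z t => by simp

theorem isIndepOf_X {i j : σ} (h : j ≠ i) : IsIndepOf i (X j) := fun z t => by
  simp [h]

/-- Division with remainder by a polynomial `e = c - X i ^ 2`. -/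
theorem exists_eq_mul_add_add_X_mul {i : σ} {c : MvPolynomial σ ℝ} (hc : IsIndepOf i c)
    (q : MvPolynomial σ ℝ) :
    ∃ h A B, IsIndepOf i A ∧ IsIndepOf i B ∧ q = h * (c - X i ^ 2) + A + X i * B := by
  induction q using MvPolynomial.induction_on with
  | C r => exact ⟨0, C r, 0, isIndepOf_C i r, by simpa using isIndepOf_C i 0, by simp⟩
  | add q s hq hs =>
    obtain ⟨h, A, B, hA, hB, rfl⟩ := hq
    obtain ⟨h', A', B', hA', hB', rfl⟩ := hs
    exact ⟨h + h', A + A', B + B', hA.add hA', hB.add hB', by ring⟩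
  | mul_X q j hq =>
    obtain ⟨h, A, B, hA, hB, rfl⟩ := hq
    by_cases hj : j = i
    · subst hj
      exact ⟨h * X j - B, c * B, A, hc.mul hB, hA, by ring⟩
    · exact ⟨h * X j, A * X j, B * X j, hA.mul (isIndepOf_X hj), hB.mul (isIndepOf_X hj), by ring⟩

/-- If `f * q` vanishes on an open part of the zero set of `c - X i ^ 2`, where `c` and `f` do not
involve `X i` and `f ≠ 0`, then `c - X i ^ 2` divides `q`. -/
theorem dvd_of_eval_eq_zero [Fintype σ] {i : σ} {c f q : MvPolynomial σ ℝ} (hc : IsIndepOf i c)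
    (hf : IsIndepOf i f) (hf0 : f ≠ 0) {O : Set (σ → ℝ)} (hO : IsOpen O) (hne : O.Nonempty)
    (hpos : ∀ z ∈ O, 0 < eval z c)
    (hzero : ∀ z ∈ O, ∀ t, eval (Function.update z i t) (c - X i ^ 2) = 0 →
      eval (Function.update z i t) (f * q) = 0) :
    c - X i ^ 2 ∣ q := by
  obtain ⟨h, A, B, hA, hB, rfl⟩ := exists_eq_mul_add_add_X_mul hc q
  -- Both roots t = ±√c(z) lie on the zero set. There f(A + tB) = 0 for either sign, and f, A, B do
  -- not depend on t.
  have key : ∀ z ∈ O, eval z (f * A) = 0 ∧ eval z (f * B) = 0 := by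
    intro z hz
    set w := Real.sqrt (eval z c) with hw
    have hw0 : 0 < w := Real.sqrt_pos.2 (hpos z hz)
    have hw2 : w ^ 2 = eval z c := Real.sq_sqrt (hpos z hz).le
    have h1 : ∀ t, t ^ 2 = eval z c → eval z f * (eval z A + t * eval z B) = 0 := by
      intro t ht
      have he : eval (Function.update z i t) (c - X i ^ 2) = 0 := by
        rw [map_sub, hc, map_pow, eval_X, Function.update_self, ht, sub_self]
      have := hzero z hz t he
      rw [map_mul, map_add, map_add, map_mul, map_mul, he, hf, hA, hB, eval_X,
        Function.update_self] at this
      simpa using this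
    have h2 := h1 w hw2
    have h3 := h1 (-w) (by rw [neg_sq, hw2])
    rw [map_mul, map_mul]
    refine ⟨by linarith, ?_⟩
    have : w * (eval z f * eval z B) = 0 := by linarith
    exact (mul_eq_zero.1 this).resolve_left hw0.ne'
  have hA0 := (mul_eq_zero.1 (eq_zero_of_eval_eq_zero_on_isOpen hO hne fun z hz => (key z hz).1))
  have hB0 := (mul_eq_zero.1 (eq_zero_of_eval_eq_zero_on_isOpen hO hne fun z hz => (key z hz).2))
  rw [hA0.resolve_left hf0, hB0.resolve_left hf0]
  exact ⟨h, by ring⟩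

end Divisibility

end MvPolynomial

/-! ### The truncated quadratic module -/

namespace PMIData

variable {n p m na nb : ℕ} (D : PMIData n p m na nb)

/-- The cone of sums `s₀ + ∑ s i * a i + ∑ t j * b j` with sums of squares `s₀`, `s i`, `t j` of
bounded degrees. -/
noncomputable def sosCone (e : SOSDegrees na nb) :
    PointedCone ℝ (MvPolynomial (Fin n ⊕ Fin p ⊕ Fin m) ℝ) where
  carrier := {w | ∃ (s₀ : MvPolynomial (Fin n ⊕ Fin p ⊕ Fin m) ℝ)
    (s : Fin na → MvPolynomial (Fin n ⊕ Fin p ⊕ Fin m) ℝ)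
    (t : Fin nb → MvPolynomial (Fin n ⊕ Fin p ⊕ Fin m) ℝ),
    IsSOSOfDegree e.s₀ s₀ ∧ (∀ i, IsSOSOfDegree (e.s i) (s i)) ∧
    (∀ j, IsSOSOfDegree (e.t j) (t j)) ∧
    w = s₀ + ∑ i, s i * ofU (D.a i) + ∑ j, t j * ofX (D.b j)}
  zero_mem' := ⟨0, 0, 0, isSOSOfDegree_zero _, fun _ => isSOSOfDegree_zero _,
    fun _ => isSOSOfDegree_zero _, by simp⟩
  add_mem' := by
    rintro _ _ ⟨s₀, s, t, h₀, hs, ht, rfl⟩ ⟨s₀', s', t', h₀', hs', ht', rfl⟩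
    refine ⟨s₀ + s₀', s + s', t + t', h₀.add h₀', fun i => (hs i).add (hs' i),
      fun j => (ht j).add (ht' j), ?_⟩
    simp only [Pi.add_apply, add_mul, Finset.sum_add_distrib]
    ring
  smul_mem' := by
    rintro ⟨c, hc⟩ _ ⟨s₀, s, t, h₀, hs, ht, rfl⟩
    refine ⟨c • s₀, fun i => c • s i, fun j => c • t j, h₀.smul hc, fun i => (hs i).smul hc,
      fun j => (ht j).smul hc, ?_⟩
    change c • (s₀ + ∑ i, s i * ofU (D.a i) + ∑ j, t j * ofX (D.b j)) = _
    simp only [smul_add, Finset.smul_sum, smul_mul_assoc]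

variable {D} {e : SOSDegrees na nb}

theorem mem_sosCone_of_isSOS {q : MvPolynomial (Fin n ⊕ Fin p ⊕ Fin m) ℝ}
    (hq : IsSOSOfDegree e.s₀ q) : q ∈ D.sosCone e :=
  ⟨q, 0, 0, hq, fun _ => isSOSOfDegree_zero _, fun _ => isSOSOfDegree_zero _, by simp⟩

theorem mul_ofU_mem_sosCone {i : Fin na} {q : MvPolynomial (Fin n ⊕ Fin p ⊕ Fin m) ℝ}
    (hq : IsSOSOfDegree (e.s i) q) : q * ofU (D.a i) ∈ D.sosCone e := by
  refine ⟨0, Pi.single i q, 0, isSOSOfDegree_zero _, fun k => ?_,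
    fun _ => isSOSOfDegree_zero _, ?_⟩
  · rcases eq_or_ne k i with rfl | hk
    · simpa using hq
    · simpa [hk] using isSOSOfDegree_zero _
  · rw [Finset.sum_eq_single i] <;> simp +contextual

theorem mul_ofX_mem_sosCone {j : Fin nb} {q : MvPolynomial (Fin n ⊕ Fin p ⊕ Fin m) ℝ}
    (hq : IsSOSOfDegree (e.t j) q) : q * ofX (D.b j) ∈ D.sosCone e := by
  refine ⟨0, 0, Pi.single j q, isSOSOfDegree_zero _, fun _ => isSOSOfDegree_zero _,
    fun k => ?_, ?_⟩
  · rcases eq_or_ne k j with rfl | hk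
    · simpa using hq
    · simpa [hk] using isSOSOfDegree_zero _
  · simp [Pi.single_apply]

variable (D e) in
/-- The truncated quadratic module of the constraints, including the sphere equation. -/
noncomputable def truncModule : PointedCone ℝ (MvPolynomial (Fin n ⊕ Fin p ⊕ Fin m) ℝ) where
  carrier := {w | ∃ (r c : MvPolynomial (Fin n ⊕ Fin p ⊕ Fin m) ℝ),
    r.totalDegree ≤ 2 * e.r ∧ c ∈ D.sosCone e ∧ w = r * sphere n p m + c}
  zero_mem' := ⟨0, 0, by simp, zero_mem _, by simp⟩
  add_mem' := by
    rintro _ _ ⟨r, c, hr, hc, rfl⟩ ⟨r', c', hr', hc', rfl⟩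
    exact ⟨r + r', c + c', (totalDegree_add _ _).trans (max_le hr hr'), add_mem hc hc', by ring⟩
  smul_mem' := by
    rintro ⟨x, hx⟩ _ ⟨r, c, hr, hc, rfl⟩
    refine ⟨x • r, x • c, (totalDegree_smul_le _ _).trans hr, PointedCone.smul_mem _ hx hc, ?_⟩
    change x • (r * sphere n p m + c) = _
    rw [smul_add, smul_mul_assoc]

theorem sosCone_le_truncModule : D.sosCone e ≤ D.truncModule e := fun c hc =>
  ⟨0, c, by simp, hc, by simp⟩

theorem mul_sphere_mem_truncModule {r : MvPolynomial (Fin n ⊕ Fin p ⊕ Fin m) ℝ}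
    (hr : r.totalDegree ≤ 2 * e.r) : r * sphere n p m ∈ D.truncModule e :=
  ⟨r, 0, hr, zero_mem _, by simp⟩

theorem sosFeasible_iff {d : ℕ} {g : MvPolynomial (Fin n) ℝ} :
    D.SOSFeasible d e g ↔ g.totalDegree ≤ 2 * d ∧ D.quadForm - ofX g ∈ D.truncModule e := by
  refine and_congr_right fun _ => ⟨?_, ?_⟩
  · rintro ⟨r, s₀, s, t, hr, h₀, hs, ht, h⟩
    exact ⟨r, _, hr, ⟨s₀, s, t, h₀, hs, ht, rfl⟩, by rw [h]; ring⟩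
  · rintro ⟨r, _, hr, ⟨s₀, s, t, h₀, hs, ht, rfl⟩, h⟩
    exact ⟨r, s₀, s, t, hr, h₀, hs, ht, by rw [h]; ring⟩

theorem sosCone_mono {e' : SOSDegrees na nb} (h₀ : e.s₀ ≤ e'.s₀) (hs : ∀ i, e.s i ≤ e'.s i)
    (ht : ∀ j, e.t j ≤ e'.t j) : D.sosCone e ≤ D.sosCone e' := by
  rintro _ ⟨s₀, s, t, h₀', hs', ht', rfl⟩
  exact ⟨s₀, s, t, h₀'.mono h₀, fun i => (hs' i).mono (hs i), fun j => (ht' j).mono (ht j), rfl⟩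

theorem Admissible.truncModule_le {d : ℕ} (he : D.Admissible d e) :
    D.truncModule (D.lowestDegrees d) ≤ D.truncModule e := by
  rintro _ ⟨r, c, hr, hc, rfl⟩
  have := he.r_ge
  exact ⟨r, c, by omega, sosCone_mono he.s₀_ge he.s_ge he.t_ge hc, rfl⟩

/-- The degree bounds guard against truncation in d - ⌈deg/2⌉, and 1 ≤ d against truncation in d -
1. -/
theorem admissible_lowestDegrees {d : ℕ} (hd : 1 ≤ d) (ha : ∀ i, (D.a i).totalDegree ≤ 2 * d)
    (hb : ∀ j, (D.b j).totalDegree ≤ 2 * d) : D.Admissible d (D.lowestDegrees d) where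
  r_ge := le_rfl
  s₀_ge := le_rfl
  s_ge _ := le_rfl
  t_ge _ := le_rfl
  s₀_le := by simp only [lowestDegrees]; omega
  s_le i := by
    have := ha i
    simp only [lowestDegrees, halfDegree]
    omega
  t_le j := by
    have := hb j
    simp only [lowestDegrees, halfDegree]
    omega

/-! ### Evaluation -/

theorem eval_ofX (z : Fin n ⊕ Fin p ⊕ Fin m → ℝ) (g : MvPolynomial (Fin n) ℝ) :
    eval z (ofX g : MvPolynomial (Fin n ⊕ Fin p ⊕ Fin m) ℝ) = eval (fun i => z (.inl i)) g :=
  eval_rename _ _ _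

theorem eval_ofU (z : Fin n ⊕ Fin p ⊕ Fin m → ℝ) (g : MvPolynomial (Fin p) ℝ) :
    eval z (ofU g : MvPolynomial (Fin n ⊕ Fin p ⊕ Fin m) ℝ) =
      eval (fun i => z (.inr (.inl i))) g :=
  eval_rename _ _ _

theorem eval_sphere (z : Fin n ⊕ Fin p ⊕ Fin m → ℝ) :
    eval z (sphere n p m) = 1 - ∑ k, z (.inr (.inr k)) ^ 2 := by
  simp [sphere, varV]

theorem eval_quadForm (x : Fin n → ℝ) (u : Fin p → ℝ) (v : Fin m → ℝ) :
    eval (Sum.elim x (Sum.elim u v)) D.quadForm =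
      v ⬝ᵥ (D.P.map (eval (Sum.elim x u)) *ᵥ v) := by
  have h : ∀ k l, eval (Sum.elim x (Sum.elim u v)) (rename (Sum.map id Sum.inl) (D.P k l)) =
      eval (Sum.elim x u) (D.P k l) := by
    intro k l
    rw [eval_rename]
    congr 2
    funext i
    rcases i with i | i <;> rfl
  simp only [quadForm, map_sum, map_mul, h, varV, eval_X, Sum.elim_inr, dotProduct,
    Matrix.mulVec, Matrix.map_apply, Finset.mul_sum, mul_assoc]

variable (D) in
/-- The set `B × U × S^(m-1)` of all `(x, u, v)`. -/
def feasibleSet : Set (Fin n ⊕ Fin p ⊕ Fin m → ℝ) :=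
  {z | (fun i => z (.inl i)) ∈ D.B ∧ (fun i => z (.inr (.inl i))) ∈ D.U ∧
    ∑ k, z (.inr (.inr k)) ^ 2 = 1}

theorem eval_nonneg_of_mem_sosCone {w : MvPolynomial (Fin n ⊕ Fin p ⊕ Fin m) ℝ}
    (hw : w ∈ D.sosCone e) {z : Fin n ⊕ Fin p ⊕ Fin m → ℝ} (hz : z ∈ D.feasibleSet) :
    0 ≤ eval z w := by
  obtain ⟨s₀, s, t, h₀, hs, ht, rfl⟩ := hw
  simp only [map_add, map_sum, map_mul]
  refine add_nonneg (add_nonneg (eval_nonneg_of_isSumSq h₀.1 z) ?_) ?_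
  · refine Finset.sum_nonneg fun i _ => mul_nonneg (eval_nonneg_of_isSumSq (hs i).1 z) ?_
    rw [eval_ofU]
    exact hz.2.1 i
  · refine Finset.sum_nonneg fun j _ => mul_nonneg (eval_nonneg_of_isSumSq (ht j).1 z) ?_
    rw [eval_ofX]
    exact hz.1 j

theorem eval_nonneg_of_mem_truncModule {w : MvPolynomial (Fin n ⊕ Fin p ⊕ Fin m) ℝ}
    (hw : w ∈ D.truncModule e) {z : Fin n ⊕ Fin p ⊕ Fin m → ℝ} (hz : z ∈ D.feasibleSet) :
    0 ≤ eval z w := by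
  obtain ⟨r, c, _, hc, rfl⟩ := hw
  rw [map_add, map_mul, eval_sphere, hz.2.2, sub_self, mul_zero, zero_add]
  exact eval_nonneg_of_mem_sosCone hc hz

theorem totalDegree_quadForm_le : D.quadForm.totalDegree ≤ 2 + D.degP := by
  refine totalDegree_finsetSum_le fun k _ => totalDegree_finsetSum_le fun l _ => ?_
  have h1 := totalDegree_mul (varV n p k * rename (Sum.map id Sum.inl) (D.P k l)) (varV n p l)
  have h2 := totalDegree_mul (varV n p k) (rename (Sum.map id Sum.inl) (D.P k l))
  have h3 := totalDegree_rename_le (Sum.map id Sum.inl : _ → Fin n ⊕ Fin p ⊕ Fin m) (D.P k l)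
  have h4 : (D.P k l).totalDegree ≤ D.degP :=
    Finset.le_sup (f := fun k : Fin m × Fin m => (D.P k.1 k.2).totalDegree)
      (Finset.mem_univ (k, l))
  have h5 : ∀ k : Fin m, (varV n p k).totalDegree = 1 := fun k => totalDegree_X _
  have := h5 k
  have := h5 l
  omega

theorem totalDegree_ofX_le (g : MvPolynomial (Fin n) ℝ) :
    (ofX g : MvPolynomial (Fin n ⊕ Fin p ⊕ Fin m) ℝ).totalDegree ≤ g.totalDegree :=
  totalDegree_rename_le _ _

theorem totalDegree_ofU_le (g : MvPolynomial (Fin p) ℝ) :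
    (ofU g : MvPolynomial (Fin n ⊕ Fin p ⊕ Fin m) ℝ).totalDegree ≤ g.totalDegree :=
  totalDegree_rename_le _ _

/-! ### The Archimedean property with degree bounds -/

theorem _root_.totalDegree_ballPoly_le (k : ℕ) (R : ℝ) : (ballPoly k R).totalDegree ≤ 2 := by
  refine (totalDegree_sub _ _).trans (max_le ((totalDegree_C _).trans_le zero_le_two) ?_)
  exact totalDegree_finsetSum_le fun i _ => (totalDegree_X_pow _ _).le

/-- Adding back the squares (q X_l)² for l ≠ i isolates one variable of a ball constraint; they have
degree at most 2d because deg q ≤ d - 1. -/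
theorem mul_self_mul_sub_sq_mem_truncModule {d k : ℕ} (hd : 1 ≤ d)
    {ι : Fin k → Fin n ⊕ Fin p ⊕ Fin m} {R : ℝ}
    {q : MvPolynomial (Fin n ⊕ Fin p ⊕ Fin m) ℝ} (hq : q.totalDegree ≤ d - 1)
    (h : q * q * (C (R ^ 2) - ∑ i, X (ι i) ^ 2) ∈ D.truncModule (D.lowestDegrees d)) (i : Fin k) :
    q * q * (C (R ^ 2) - X (ι i) ^ 2) ∈ D.truncModule (D.lowestDegrees d) := by
  have hsq : ∀ l, q * X (ι l) * (q * X (ι l)) ∈ D.truncModule (D.lowestDegrees d) := by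
    intro l
    refine sosCone_le_truncModule (mem_sosCone_of_isSOS (isSOSOfDegree_mul_self ?_))
    refine (totalDegree_mul _ _).trans ?_
    rw [totalDegree_X]
    simp only [lowestDegrees]
    omega
  have : q * q * (C (R ^ 2) - X (ι i) ^ 2) = q * q * (C (R ^ 2) - ∑ i, X (ι i) ^ 2) +
      ∑ l ∈ Finset.univ.erase i, q * X (ι l) * (q * X (ι l)) := by
    have h1 := Finset.add_sum_erase Finset.univ
      (fun l => (X (ι l) : MvPolynomial (Fin n ⊕ Fin p ⊕ Fin m) ℝ) ^ 2) (Finset.mem_univ i)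
    have h2 : ∑ l ∈ Finset.univ.erase i, q * X (ι l) * (q * X (ι l)) =
        q * q * ∑ l ∈ Finset.univ.erase i, X (ι l) ^ 2 := by
      rw [Finset.mul_sum]
      exact Finset.sum_congr rfl fun _ _ => by ring
    rw [h2, ← h1]
    ring
  rw [this]
  exact add_mem h (sum_mem fun l _ => hsq l)

/-- Each kind of variable is bounded by its own constraint: x by the ball among the b j, u by the
ball among the a i, v by the sphere equation with R = 1. -/
theorem exists_mul_self_mul_sub_sq_mem {d : ℕ} (hd : 1 ≤ d)
    (hUball : ∃ i R, D.a i = ballPoly p R) (hBball : ∃ j R, D.b j = ballPoly n R)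
    (k : Fin n ⊕ Fin p ⊕ Fin m) :
    ∃ R : ℝ, ∀ q : MvPolynomial (Fin n ⊕ Fin p ⊕ Fin m) ℝ, q.totalDegree ≤ d - 1 →
      q * q * (C (R ^ 2) - X k ^ 2) ∈ D.truncModule (D.lowestDegrees d) := by
  rcases k with k | k | k
  · obtain ⟨j, R, hj⟩ := hBball
    refine ⟨R, fun q hq => mul_self_mul_sub_sq_mem_truncModule hd (ι := Sum.inl) hq ?_ k⟩
    have h : (ofX (D.b j) : MvPolynomial (Fin n ⊕ Fin p ⊕ Fin m) ℝ) =
        C (R ^ 2) - ∑ i, X (Sum.inl i) ^ 2 := by simp [ofX, hj, ballPoly]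
    rw [← h]
    refine sosCone_le_truncModule (mul_ofX_mem_sosCone (isSOSOfDegree_mul_self (hq.trans ?_)))
    have := totalDegree_ballPoly_le n R
    simp only [lowestDegrees, halfDegree, hj]
    omega
  · obtain ⟨j, R, hj⟩ := hUball
    refine ⟨R, fun q hq => mul_self_mul_sub_sq_mem_truncModule hd
      (ι := fun i => Sum.inr (Sum.inl i)) hq ?_ k⟩
    have h : (ofU (D.a j) : MvPolynomial (Fin n ⊕ Fin p ⊕ Fin m) ℝ) =
        C (R ^ 2) - ∑ i, X (Sum.inr (Sum.inl i)) ^ 2 := by simp [ofU, hj, ballPoly]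
    rw [← h]
    refine sosCone_le_truncModule (mul_ofU_mem_sosCone (isSOSOfDegree_mul_self (hq.trans ?_)))
    have := totalDegree_ballPoly_le p R
    simp only [lowestDegrees, halfDegree, hj]
    omega
  · refine ⟨1, fun q hq => mul_self_mul_sub_sq_mem_truncModule hd
      (ι := fun i => Sum.inr (Sum.inr i)) hq ?_ k⟩
    have h : C ((1 : ℝ) ^ 2) - ∑ i, X (Sum.inr (Sum.inr i)) ^ 2 = sphere n p m := by
      simp [sphere, varV]
    rw [h]
    refine mul_sphere_mem_truncModule ?_
    rw [totalDegree_mul_self]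
    simp only [lowestDegrees]
    omega

/-- Induction on the degree, from R²N - X_i²z^(2β) = z^(2β)(R² - X_i²) + R²(N - z^(2β)). -/
theorem exists_sub_monomial_sq_mem {d : ℕ} (hd : 1 ≤ d)
    (hUball : ∃ i R, D.a i = ballPoly p R) (hBball : ∃ j R, D.b j = ballPoly n R)
    (γ : Fin n ⊕ Fin p ⊕ Fin m →₀ ℕ) (hγ : γ.degree ≤ d) :
    ∃ N : ℝ, C N - monomial γ 1 * monomial γ 1 ∈ D.truncModule (D.lowestDegrees d) := by
  induction hk : γ.degree generalizing γ with
  | zero =>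
    rw [Finsupp.degree_eq_zero_iff] at hk
    subst hk
    exact ⟨1, by simp⟩
  | succ k ih =>
    obtain ⟨i, hi⟩ : ∃ i, γ i ≠ 0 := by
      by_contra! h
      have : γ = 0 := Finsupp.ext h
      simp [this] at hk
    have hle : Finsupp.single i 1 ≤ γ := by
      simpa [Finsupp.single_le_iff] using Nat.one_le_iff_ne_zero.2 hi
    obtain ⟨β, rfl⟩ := exists_add_of_le hle
    have hβ : β.degree = k := by
      rw [map_add, Finsupp.degree_single] at hk
      omega
    obtain ⟨N, hN⟩ := ih β (by omega) hβ
    obtain ⟨R, hR⟩ := exists_mul_self_mul_sub_sq_mem hd hUball hBball i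
    refine ⟨R ^ 2 * N, ?_⟩
    have hmon : (monomial (Finsupp.single i 1 + β) 1 : MvPolynomial (Fin n ⊕ Fin p ⊕ Fin m) ℝ) =
        X i * monomial β 1 := by
      rw [X, monomial_mul, one_mul]
    have : C (R ^ 2 * N) - monomial (Finsupp.single i 1 + β) 1 *
        monomial (Finsupp.single i 1 + β) 1 =
        monomial β 1 * monomial β 1 * (C (R ^ 2) - X i ^ 2) +
          R ^ 2 • (C N - monomial β 1 * monomial β 1) := by
      rw [hmon, smul_eq_C_mul, C_mul]
      ring
    rw [this]
    refine add_mem (hR _ ?_) (PointedCone.smul_mem _ (sq_nonneg R) hN)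
    exact (totalDegree_monomial_le _ _).trans (by change β.degree ≤ d - 1; omega)

/-- Polarization: a monomial of degree at most 2d splits as AB with both factors of degree at most
d, and 2cAB = (cA + B)² - c²A² - B². -/
theorem exists_add_monomial_mem {d : ℕ} (hd : 1 ≤ d)
    (hUball : ∃ i R, D.a i = ballPoly p R) (hBball : ∃ j R, D.b j = ballPoly n R)
    (γ : Fin n ⊕ Fin p ⊕ Fin m →₀ ℕ) (hγ : γ.degree ≤ 2 * d) (c : ℝ) :
    ∃ N : ℝ, C N + monomial γ c ∈ D.truncModule (D.lowestDegrees d) := by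
  obtain ⟨α, hα, hαd⟩ := Finsupp.exists_le_degree_eq γ (min d γ.degree) (min_le_right _ _)
  obtain ⟨β, rfl⟩ := exists_add_of_le hα
  rw [map_add] at hγ hαd
  obtain ⟨N₁, h₁⟩ := exists_sub_monomial_sq_mem hd hUball hBball α (by omega)
  obtain ⟨N₂, h₂⟩ := exists_sub_monomial_sq_mem hd hUball hBball β (by omega)
  set A : MvPolynomial (Fin n ⊕ Fin p ⊕ Fin m) ℝ := monomial α 1 with hA
  set B : MvPolynomial (Fin n ⊕ Fin p ⊕ Fin m) ℝ := monomial β 1 with hB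
  have hsq : (C c * A + B) * (C c * A + B) ∈ D.truncModule (D.lowestDegrees d) := by
    refine sosCone_le_truncModule (mem_sosCone_of_isSOS (isSOSOfDegree_mul_self ?_))
    refine (totalDegree_add _ _).trans (max_le ?_ ?_)
    · rw [← smul_eq_C_mul]
      refine (totalDegree_smul_le _ _).trans ((totalDegree_monomial_le _ _).trans ?_)
      change α.degree ≤ d
      omega
    · refine (totalDegree_monomial_le _ _).trans ?_
      change β.degree ≤ d
      omega
  have hmon : (monomial (α + β) c : MvPolynomial (Fin n ⊕ Fin p ⊕ Fin m) ℝ) = C c * (A * B) := by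
    rw [hA, hB, monomial_mul, C_mul_monomial]
    simp
  refine ⟨(1 / 2) * (c ^ 2 * N₁ + N₂), ?_⟩
  have : C ((1 / 2) * (c ^ 2 * N₁ + N₂)) + monomial (α + β) c =
      (1 / 2 : ℝ) • ((C c * A + B) * (C c * A + B) + c ^ 2 • (C N₁ - A * A) + (C N₂ - B * B)) := by
    rw [hmon, smul_eq_C_mul, smul_eq_C_mul]
    have h2 : (C (1 / 2 : ℝ) : MvPolynomial (Fin n ⊕ Fin p ⊕ Fin m) ℝ) * 2 = 1 := by
      rw [show (2 : MvPolynomial (Fin n ⊕ Fin p ⊕ Fin m) ℝ) = C 2 from (map_ofNat C 2).symm,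
        ← C_mul]
      norm_num
    simp only [C_mul, C_add, C_pow]
    linear_combination (-(C c * (A * B))) * h2
  rw [this]
  exact PointedCone.smul_mem _ (by norm_num)
    (add_mem (add_mem hsq (PointedCone.smul_mem _ (sq_nonneg c) h₁)) h₂)

theorem exists_add_mem_truncModule {d : ℕ} (hd : 1 ≤ d)
    (hUball : ∃ i R, D.a i = ballPoly p R) (hBball : ∃ j R, D.b j = ballPoly n R)
    {w : MvPolynomial (Fin n ⊕ Fin p ⊕ Fin m) ℝ} (hw : w.totalDegree ≤ 2 * d) :
    ∃ N : ℝ, C N + w ∈ D.truncModule (D.lowestDegrees d) := by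
  have h : ∀ γ : w.support, ∃ N : ℝ,
      C N + monomial γ.1 (coeff γ.1 w) ∈ D.truncModule (D.lowestDegrees d) := fun γ =>
    exists_add_monomial_mem hd hUball hBball _ ((le_totalDegree γ.2).trans hw) _
  choose N hN using h
  refine ⟨∑ γ, N γ, ?_⟩
  have : C (∑ γ, N γ) + w = ∑ γ, (C (N γ) + monomial γ.1 (coeff γ.1 w)) := by
    rw [Finset.sum_add_distrib, map_sum]
    congr 1
    rw [Finset.sum_coe_sort w.support (fun γ => monomial γ (coeff γ w))]
    exact (support_sum_monomial_coeff w).symm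
  rw [this]
  exact sum_mem fun γ _ => hN γ

end PMIData

namespace PMIData

variable {n p m na nb : ℕ} {D : PMIData n p m na nb} {e : SOSDegrees na nb}

/-! ### Compactness -/

theorem _root_.isCompact_of_eq_ballPoly {k N : ℕ} {c : Fin N → MvPolynomial (Fin k) ℝ}
    (h : ∃ i R, c i = ballPoly k R) : IsCompact {z : Fin k → ℝ | ∀ i, 0 ≤ eval z (c i)} := by
  obtain ⟨i, R, hi⟩ := h
  refine Metric.isCompact_of_isClosed_isBounded ?_ ?_
  · simp only [Set.ofPred_forall]
    exact isClosed_iInter fun i => isClosed_le continuous_const (MvPolynomial.continuous_eval _)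
  · refine (Metric.isBounded_closedBall (x := (0 : Fin k → ℝ)) (r := |R|)).subset fun z hz => ?_
    rw [mem_closedBall_zero_iff, pi_norm_le_iff_of_nonneg (abs_nonneg R)]
    intro l
    have h1 : ∑ i, z i ^ 2 ≤ R ^ 2 := by
      have := hz i
      rw [hi] at this
      simpa [ballPoly] using this
    have h2 : z l ^ 2 ≤ ∑ i, z i ^ 2 :=
      Finset.single_le_sum (f := fun i => z i ^ 2) (fun i _ => sq_nonneg _) (Finset.mem_univ l)
    exact sq_le_sq.1 (h2.trans h1)

theorem isCompact_B (hBball : ∃ j R, D.b j = ballPoly n R) : IsCompact D.B :=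
  isCompact_of_eq_ballPoly hBball

theorem isCompact_U (hUball : ∃ j R, D.a j = ballPoly p R) : IsCompact D.U :=
  isCompact_of_eq_ballPoly hUball

theorem _root_.isCompact_setOf_sum_sq_eq_one (m : ℕ) :
    IsCompact {v : Fin m → ℝ | ∑ k, v k ^ 2 = 1} := by
  refine Metric.isCompact_of_isClosed_isBounded ?_ ?_
  · exact isClosed_eq (by fun_prop) continuous_const
  · refine (Metric.isBounded_closedBall (x := (0 : Fin m → ℝ)) (r := 1)).subset fun v hv => ?_
    rw [mem_closedBall_zero_iff, pi_norm_le_iff_of_nonneg zero_le_one]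
    intro l
    have h2 : v l ^ 2 ≤ ∑ i, v i ^ 2 :=
      Finset.single_le_sum (f := fun i => v i ^ 2) (fun i _ => sq_nonneg _) (Finset.mem_univ l)
    rw [show ∑ i, v i ^ 2 = 1 from hv] at h2
    exact (sq_le_one_iff_abs_le_one _).1 h2

variable (D) in
/-- The set `U × S^(m-1)` of all `(u, v)`. -/
def fiber : Set ((Fin p → ℝ) × (Fin m → ℝ)) := D.U ×ˢ {v | ∑ k, v k ^ 2 = 1}

theorem isCompact_fiber (hUball : ∃ j R, D.a j = ballPoly p R) : IsCompact D.fiber :=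
  (isCompact_U hUball).prod (isCompact_setOf_sum_sq_eq_one m)

theorem fiber_nonempty (hm : 0 < m) (hU : D.U.Nonempty) : D.fiber.Nonempty := by
  obtain ⟨u, hu⟩ := hU
  refine ⟨(u, Pi.single ⟨0, hm⟩ 1), hu, ?_⟩
  simp [Pi.single_apply]

theorem continuous_sumElim {X A B : Type*} [TopologicalSpace X] {f : X → A → ℝ} {g : X → B → ℝ}
    (hf : Continuous f) (hg : Continuous g) : Continuous fun x => Sum.elim (f x) (g x) := by
  refine continuous_pi fun i => ?_
  rcases i with i | i
  · exact (continuous_apply i).comp hf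
  · exact (continuous_apply i).comp hg

theorem mem_feasibleSet_iff {x : Fin n → ℝ} {u : Fin p → ℝ} {v : Fin m → ℝ} :
    Sum.elim x (Sum.elim u v) ∈ D.feasibleSet ↔ x ∈ D.B ∧ (u, v) ∈ D.fiber := Iff.rfl

theorem isCompact_feasibleSet (hUball : ∃ j R, D.a j = ballPoly p R)
    (hBball : ∃ j R, D.b j = ballPoly n R) : IsCompact D.feasibleSet := by
  have : D.feasibleSet = (fun q : (Fin n → ℝ) × (Fin p → ℝ) × (Fin m → ℝ) =>
      Sum.elim q.1 (Sum.elim q.2.1 q.2.2)) '' (D.B ×ˢ D.fiber) := by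
    ext z
    constructor
    · intro hz
      refine ⟨(fun i => z (.inl i), fun i => z (.inr (.inl i)), fun i => z (.inr (.inr i))),
        ⟨hz.1, hz.2⟩, ?_⟩
      funext i
      rcases i with i | i | i <;> rfl
    · rintro ⟨⟨x, u, v⟩, ⟨hx, huv⟩, rfl⟩
      exact ⟨hx, huv⟩
  rw [this]
  refine ((isCompact_B hBball).prod (isCompact_fiber hUball)).image ?_
  exact continuous_sumElim (by fun_prop) (continuous_sumElim (by fun_prop) (by fun_prop))

/-! ### The robust minimum eigenvalue -/

theorem robustMinEig_eq_sInf_image (x : Fin n → ℝ) :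
    D.robustMinEig x =
      sInf ((fun y => eval (Sum.elim x (Sum.elim y.1 y.2)) D.quadForm) '' D.fiber) := by
  unfold robustMinEig
  congr 1
  ext c
  simp only [Set.mem_image, Prod.exists, eval_quadForm, fiber, Set.mem_prod, Set.mem_ofPred_eq]
  constructor
  · rintro ⟨u, hu, v, hv, rfl⟩
    refine ⟨u, v, ⟨hu, ?_⟩, rfl⟩
    simpa [dotProduct, sq] using hv
  · rintro ⟨u, v, ⟨hu, hv⟩, rfl⟩
    refine ⟨u, hu, v, ?_, rfl⟩
    simpa [dotProduct, sq] using hv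

theorem continuous_robustMinEig (hUball : ∃ j R, D.a j = ballPoly p R) :
    Continuous D.robustMinEig := by
  have h : Continuous fun q : (Fin n → ℝ) × (Fin p → ℝ) × (Fin m → ℝ) =>
      Sum.elim q.1 (Sum.elim q.2.1 q.2.2) :=
    continuous_sumElim (by fun_prop) (continuous_sumElim (by fun_prop) (by fun_prop))
  let f : (Fin n → ℝ) → (Fin p → ℝ) × (Fin m → ℝ) → ℝ := fun x y =>
    eval (Sum.elim x (Sum.elim y.1 y.2)) D.quadForm
  have hf : Continuous (Function.uncurry f) := (MvPolynomial.continuous_eval D.quadForm).comp h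
  have hsInf : Continuous fun x => sInf (f x '' D.fiber) :=
    (isCompact_fiber hUball).continuous_sInf hf
  exact hsInf.congr fun x => (robustMinEig_eq_sInf_image x).symm

theorem integrableOn_robustMinEig (hUball : ∃ j R, D.a j = ballPoly p R)
    (hBball : ∃ j R, D.b j = ballPoly n R) : IntegrableOn D.robustMinEig D.B :=
  (continuous_robustMinEig hUball).continuousOn.integrableOn_compact (isCompact_B hBball)

theorem integrableOn_eval (hBball : ∃ j R, D.b j = ballPoly n R) (g : MvPolynomial (Fin n) ℝ) :
    IntegrableOn (fun x => eval x g) D.B :=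
  (MvPolynomial.continuous_eval g).continuousOn.integrableOn_compact (isCompact_B hBball)

theorem SOSFeasible.eval_le_robustMinEig (hm : 0 < m) (hU : D.U.Nonempty) {d : ℕ}
    {g : MvPolynomial (Fin n) ℝ} (hg : D.SOSFeasible d e g) {x : Fin n → ℝ} (hx : x ∈ D.B) :
    eval x g ≤ D.robustMinEig x := by
  rw [robustMinEig_eq_sInf_image]
  refine le_csInf ((fiber_nonempty hm hU).image _) ?_
  rintro _ ⟨⟨u, v⟩, huv, rfl⟩
  have := eval_nonneg_of_mem_truncModule (sosFeasible_iff.1 hg).2 (mem_feasibleSet_iff.2 ⟨hx, huv⟩)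
  rw [map_sub, eval_ofX] at this
  simp only [Sum.elim_inl] at this
  linarith

/-! ### Polynomials vanishing on the feasible set -/

/-- The sphere equation is solved for one coordinate of v, over an open set of the remaining
variables; the nonempty interiors of U and B supply that set. The factor f allows zeros of a weight
to be ignored. -/
theorem sphere_dvd (hm : 0 < m) (hU : (interior D.U).Nonempty) (hB : (interior D.B).Nonempty)
    {f q : MvPolynomial (Fin n ⊕ Fin p ⊕ Fin m) ℝ}
    (hf : ∀ k : Fin m, IsIndepOf (Sum.inr (Sum.inr k)) f) (hf0 : f ≠ 0)
    (hzero : ∀ x ∈ interior D.B, ∀ y ∈ D.fiber,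
      eval (Sum.elim x (Sum.elim y.1 y.2)) (f * q) = 0) : sphere n p m ∣ q := by
  set k₀ : Fin m := ⟨0, hm⟩
  set c : MvPolynomial (Fin n ⊕ Fin p ⊕ Fin m) ℝ :=
    1 - ∑ k ∈ Finset.univ.erase k₀, varV n p k ^ 2 with hc
  have hsphere : sphere n p m = c - X (Sum.inr (Sum.inr k₀)) ^ 2 := by
    rw [sphere, hc, ← Finset.add_sum_erase Finset.univ _ (Finset.mem_univ k₀)]
    simp only [varV]
    ring
  have hceval : ∀ z, eval z c = 1 - ∑ k ∈ Finset.univ.erase k₀, z (.inr (.inr k)) ^ 2 := by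
    intro z
    simp [hc, varV]
  have hcind : IsIndepOf (Sum.inr (Sum.inr k₀)) c := by
    intro z t
    rw [hceval, hceval]
    congr 1
    refine Finset.sum_congr rfl fun k hk => ?_
    rw [Function.update_of_ne (by simpa using Finset.ne_of_mem_erase hk)]
  rw [hsphere]
  obtain ⟨x₀, hx₀⟩ := hB
  obtain ⟨u₀, hu₀⟩ := hU
  refine dvd_of_eval_eq_zero hcind (hf k₀) hf0
    -- Nonempty because v = 0 gives c = 1.
    (O := {z | (fun i => z (.inl i)) ∈ interior D.B} ∩
      ({z | (fun i => z (.inr (.inl i))) ∈ interior D.U} ∩ {z | 0 < eval z c})) ?_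
    ⟨Sum.elim x₀ (Sum.elim u₀ 0), hx₀, hu₀, by simp [hceval]⟩ (fun z hz => hz.2.2) ?_
  · refine (isOpen_interior.preimage (by fun_prop)).inter
      ((isOpen_interior.preimage (by fun_prop)).inter ?_)
    exact isOpen_lt continuous_const (MvPolynomial.continuous_eval _)
  · rintro z ⟨hzB, hzU, -⟩ t ht
    rw [← hsphere, eval_sphere] at ht
    have h := hzero (fun i => z (.inl i)) hzB (fun i => z (.inr (.inl i)),
      fun k => Function.update z (.inr (.inr k₀)) t (.inr (.inr k)))
      ⟨interior_subset hzU, by simp only [Set.mem_ofPred_eq]; linarith⟩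
    convert h using 2
    congr 1
    funext i
    rcases i with i | i | i
    · exact Function.update_of_ne (by simp) _ _
    · exact Function.update_of_ne (by simp) _ _
    · rfl

theorem isIndepOf_ofX (k : Fin m) (g : MvPolynomial (Fin n) ℝ) :
    IsIndepOf (Sum.inr (Sum.inr k)) (ofX g : MvPolynomial (Fin n ⊕ Fin p ⊕ Fin m) ℝ) := by
  intro z t
  simp [eval_ofX]

theorem isIndepOf_ofU (k : Fin m) (g : MvPolynomial (Fin p) ℝ) :
    IsIndepOf (Sum.inr (Sum.inr k)) (ofU g : MvPolynomial (Fin n ⊕ Fin p ⊕ Fin m) ℝ) := by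
  intro z t
  simp [eval_ofU]

/-! ### Restriction of polynomials to the feasible set -/

variable (D) in
/-- Restriction of polynomials to the feasible set, as continuous functions. -/
noncomputable def restrict :
    MvPolynomial (Fin n ⊕ Fin p ⊕ Fin m) ℝ →ₐ[ℝ] C(D.feasibleSet, ℝ) where
  toFun w := ⟨fun z => eval z.1 w,
    (MvPolynomial.continuous_eval w).comp continuous_subtype_val⟩
  map_one' := by ext; simp
  map_mul' _ _ := by ext; simp
  map_zero' := by ext; simp
  map_add' _ _ := by ext; simp
  commutes' _ := by ext; simp

theorem restrict_apply (w : MvPolynomial (Fin n ⊕ Fin p ⊕ Fin m) ℝ) (z : D.feasibleSet) :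
    D.restrict w z = eval z.1 w := rfl

theorem restrict_sphere : D.restrict (sphere n p m) = 0 := by
  ext z
  rw [restrict_apply, eval_sphere, z.2.2.2, sub_self]
  rfl

theorem sphere_dvd_of_restrict_eq_zero (hm : 0 < m) (hU : (interior D.U).Nonempty)
    (hB : (interior D.B).Nonempty) {q : MvPolynomial (Fin n ⊕ Fin p ⊕ Fin m) ℝ}
    (hq : D.restrict q = 0) : sphere n p m ∣ q := by
  refine sphere_dvd hm hU hB (f := 1) (fun k => by simpa using isIndepOf_C _ 1) one_ne_zero
    fun x hx y hy => ?_
  rw [one_mul]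
  exact DFunLike.congr_fun hq ⟨_, mem_feasibleSet_iff.2 ⟨interior_subset hx, hy⟩⟩

/-- The section `x ↦ (x, u, v)`. -/
def sectionMap (y : D.fiber) : C(D.B, D.feasibleSet) where
  toFun x := ⟨Sum.elim x.1 (Sum.elim y.1.1 y.1.2), mem_feasibleSet_iff.2 ⟨x.2, y.2⟩⟩
  continuous_toFun := by
    refine Continuous.subtype_mk ?_ _
    exact continuous_sumElim continuous_subtype_val continuous_const

/-- Integration over `B` in a fiber. -/
noncomputable def fiberIntegral (hK : CompactSpace D.feasibleSet) (hBc : IsCompact D.B)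
    (y : D.fiber) : C(D.feasibleSet, ℝ) →L[ℝ] ℝ :=
  have : CompactSpace D.B := isCompact_iff_compactSpace.1 hBc
  have : IsFiniteMeasure (Measure.comap ((↑) : D.B → Fin n → ℝ) volume) := ⟨by
    rw [(MeasurableEmbedding.subtype_coe hBc.measurableSet).comap_apply]
    simpa using hBc.measure_lt_top⟩
  have hint : ∀ c : C(D.B, ℝ), Integrable c (Measure.comap ((↑) : D.B → Fin n → ℝ) volume) :=
    fun c => c.continuous.integrable_of_hasCompactSupport
      (HasCompactSupport.of_compactSpace _)
  LinearMap.mkContinuous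
    { toFun := fun c => ∫ x, (c.comp (sectionMap y)) x
        ∂(Measure.comap ((↑) : D.B → Fin n → ℝ) volume)
      map_add' := fun c c' => integral_add (hint (c.comp (sectionMap y)))
        (hint (c'.comp (sectionMap y)))
      map_smul' := fun r c => integral_const_mul r _ }
    ((Measure.comap ((↑) : D.B → Fin n → ℝ) volume).real Set.univ) fun c => by
      rw [mul_comm]
      exact norm_integral_le_of_norm_le_const 
        (Filter.Eventually.of_forall fun x => c.norm_coe_le_norm _)

theorem fiberIntegral_restrict (hK : CompactSpace D.feasibleSet) (hBc : IsCompact D.B)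
    (y : D.fiber) (w : MvPolynomial (Fin n ⊕ Fin p ⊕ Fin m) ℝ) :
    fiberIntegral hK hBc y (D.restrict w) =
      ∫ x in D.B, eval (Sum.elim x (Sum.elim y.1.1 y.1.2)) w :=
  integral_subtype_comap (μ := volume) hBc.measurableSet
    fun x => eval (Sum.elim x (Sum.elim y.1.1 y.1.2)) w

theorem fiberIntegral_ofX (hK : CompactSpace D.feasibleSet) (hBc : IsCompact D.B)
    (y : D.fiber) (g : MvPolynomial (Fin n) ℝ) :
    fiberIntegral hK hBc y (D.restrict (ofX g)) = D.objective g := by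
  rw [fiberIntegral_restrict]
  simp only [eval_ofX, Sum.elim_inl]
  rfl

end PMIData

namespace PMIData

variable {n p m na nb : ℕ} {D : PMIData n p m na nb} {e : SOSDegrees na nb}

/-! ### The cone of restrictions of `sosCone` -/

variable (D) in
/-- The polynomials `1`, `a i`, `b j`. -/
noncomputable def weight :
    Option (Fin na ⊕ Fin nb) → MvPolynomial (Fin n ⊕ Fin p ⊕ Fin m) ℝ
  | none => 1
  | some (.inl i) => ofU (D.a i)
  | some (.inr j) => ofX (D.b j)

/-- The half-degree of the multiplier of a weight. -/
def _root_.SOSDegrees.ofWeight (e : SOSDegrees na nb) : Option (Fin na ⊕ Fin nb) → ℕ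
  | none => e.s₀
  | some (.inl i) => e.s i
  | some (.inr j) => e.t j

theorem mul_weight_mem_sosCone {i : Option (Fin na ⊕ Fin nb)}
    {q : MvPolynomial (Fin n ⊕ Fin p ⊕ Fin m) ℝ} (hq : IsSOSOfDegree (e.ofWeight i) q) :
    q * D.weight i ∈ D.sosCone e := by
  rcases i with _ | i | j
  · rw [weight, mul_one]
    exact mem_sosCone_of_isSOS hq
  · exact mul_ofU_mem_sosCone hq
  · exact mul_ofX_mem_sosCone hq

theorem sosCone_induction {motive : MvPolynomial (Fin n ⊕ Fin p ⊕ Fin m) ℝ → Prop}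
    (zero : motive 0) (add : ∀ v w, motive v → motive w → motive (v + w))
    (mul : ∀ i q, q.totalDegree ≤ e.ofWeight i → motive (q * q * D.weight i))
    {w : MvPolynomial (Fin n ⊕ Fin p ⊕ Fin m) ℝ} (hw : w ∈ D.sosCone e) : motive w := by
  have hmul : ∀ i s, IsSOSOfDegree (e.ofWeight i) s → motive (s * D.weight i) := by
    intro i s hs
    refine hs.induction (motive := fun s => motive (s * D.weight i)) (by simpa using zero)
      fun q s hq hs => ?_
    rw [add_mul]
    exact add _ _ (mul i q hq) hs
  obtain ⟨s₀, s, t, h₀, hs, ht, rfl⟩ := hw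
  refine add _ _ (add _ _ ?_ ?_) ?_
  · simpa [weight] using hmul none s₀ h₀
  · exact Finset.sum_induction _ motive add zero fun i _ => hmul (some (.inl i)) (s i) (hs i)
  · exact Finset.sum_induction _ motive add zero fun j _ => hmul (some (.inr j)) (t j) (ht j)

theorem Admissible.ofWeight_le {d : ℕ} (he : D.Admissible d e) (i : Option (Fin na ⊕ Fin nb)) :
    2 * e.ofWeight i + (D.weight i).totalDegree ≤ 2 * e.r + 2 := by
  rcases i with _ | i | j
  · simpa [weight, SOSDegrees.ofWeight] using he.s₀_le
  · exact (Nat.add_le_add_left (totalDegree_ofU_le _) _).trans (he.s_le i)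
  · exact (Nat.add_le_add_left (totalDegree_ofX_le _) _).trans (he.t_le j)

theorem Admissible.totalDegree_mul_weight_le {d : ℕ} (he : D.Admissible d e)
    {i : Option (Fin na ⊕ Fin nb)} {q : MvPolynomial (Fin n ⊕ Fin p ⊕ Fin m) ℝ}
    (hq : q.totalDegree ≤ e.ofWeight i) : (q * q * D.weight i).totalDegree ≤ 2 * e.r + 2 := by
  have h1 := totalDegree_mul (q * q) (D.weight i)
  have h2 := he.ofWeight_le i
  rw [totalDegree_mul_self] at h1
  omega

/-- The upper bounds in admissibility enter here: no weighted square exceeds the degree allowed to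
r(1 - vᵀv). -/
theorem Admissible.totalDegree_le_of_mem_sosCone {d : ℕ} (he : D.Admissible d e)
    {w : MvPolynomial (Fin n ⊕ Fin p ⊕ Fin m) ℝ} (hw : w ∈ D.sosCone e) :
    w.totalDegree ≤ 2 * e.r + 2 :=
  sosCone_induction (motive := fun w => w.totalDegree ≤ 2 * e.r + 2) (by simp)
    (fun _ _ hv hw => (totalDegree_add _ _).trans (max_le hv hw))
    (fun _ _ hq => he.totalDegree_mul_weight_le hq) hw

theorem totalDegree_sphere_le : (sphere n p m).totalDegree ≤ 2 := by
  refine (totalDegree_sub _ _).trans (max_le (totalDegree_one.trans_le zero_le_two) ?_)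
  exact totalDegree_finsetSum_le fun k _ => (totalDegree_X_pow _ _).le

theorem Admissible.totalDegree_le_of_mem_truncModule {d : ℕ} (he : D.Admissible d e)
    {w : MvPolynomial (Fin n ⊕ Fin p ⊕ Fin m) ℝ} (hw : w ∈ D.truncModule e) :
    w.totalDegree ≤ 2 * e.r + 2 := by
  obtain ⟨r, c, hr, hc, rfl⟩ := hw
  refine (totalDegree_add _ _).trans (max_le ?_ (he.totalDegree_le_of_mem_sosCone hc))
  exact (totalDegree_mul _ _).trans (add_le_add hr totalDegree_sphere_le)

theorem totalDegree_sphere (hm : 0 < m) : (sphere n p m).totalDegree = 2 := by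
  refine le_antisymm totalDegree_sphere_le ?_
  have hcoeff : coeff (Finsupp.single (Sum.inr (Sum.inr ⟨0, hm⟩)) 2) (sphere n p m) ≠ 0 := by
    rw [sphere, coeff_sub, coeff_sum, Finset.sum_eq_single ⟨0, hm⟩]
    · rw [coeff_one, if_neg (Finsupp.single_ne_zero.2 two_ne_zero).symm]
      simp [varV, coeff_X_pow]
    · intro k _ hk
      simp [varV, coeff_X_pow, Finsupp.single_left_inj, hk]
    · simp
  have := le_totalDegree (mem_support_iff.2 hcoeff)
  simpa using this

theorem sphere_ne_zero (hm : 0 < m) : sphere n p m ≠ 0 := by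
  intro h
  have := totalDegree_sphere (n := n) (p := p) hm
  simp [h] at this

variable (D e) in
/-- Normalized generators of the cone of restrictions of `sosCone`. -/
def generators (hK : CompactSpace D.feasibleSet) : Set C(D.feasibleSet, ℝ) :=
  {c | ∃ i, D.weight i ≠ 0 ∧ ∃ q ∈ restrictTotalDegree _ ℝ (e.ofWeight i),
    ‖D.restrict q‖ = 1 ∧ c = D.restrict (q * q * D.weight i)}

/-- The norm is imposed on the restriction of q, not on its coefficients: the unit sphere of a
finite-dimensional space of functions is compact, and polynomials q vanishing on K, which would give
zero generators, are excluded. -/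
theorem isCompact_generators (hK : CompactSpace D.feasibleSet) :
    IsCompact (D.generators e hK) := by
  have heq : D.generators e hK = ⋃ i ∈ {i | D.weight i ≠ 0},
      (fun c : Submodule.map D.restrict.toLinearMap (restrictTotalDegree _ ℝ (e.ofWeight i)) =>
        c.1 * c.1 * D.restrict (D.weight i)) '' Metric.sphere 0 1 := by
    ext c
    simp only [generators, Set.mem_iUnion, Set.mem_image]
    constructor
    · rintro ⟨i, hi, q, hq, hq1, rfl⟩
      exact ⟨i, hi, ⟨D.restrict q, q, hq, rfl⟩, by simpa using hq1, by simp⟩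
    · rintro ⟨i, hi, ⟨_, q, hq, rfl⟩, hq1, rfl⟩
      exact ⟨i, hi, q, hq, by simpa using hq1, by simp⟩
  rw [heq]
  refine (Set.toFinite _).isCompact_biUnion fun i _ => ?_
  have : ProperSpace
      (Submodule.map D.restrict.toLinearMap (restrictTotalDegree _ ℝ (e.ofWeight i))) :=
    FiniteDimensional.proper_real _
  refine (isCompact_sphere _ _).image ?_
  fun_prop

theorem Admissible.generators_subset {d : ℕ} (he : D.Admissible d e)
    (hK : CompactSpace D.feasibleSet) : D.generators e hK ⊆
      Submodule.map D.restrict.toLinearMap (restrictTotalDegree _ ℝ (2 * e.r + 2)) := by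
  rintro _ ⟨i, _, q, hq, _, rfl⟩
  refine ⟨_, ?_, rfl⟩
  rw [SetLike.mem_coe, mem_restrictTotalDegree] at *
  exact he.totalDegree_mul_weight_le hq

theorem mem_hull_generators_iff (hK : CompactSpace D.feasibleSet) {c : C(D.feasibleSet, ℝ)} :
    c ∈ PointedCone.hull ℝ (D.generators e hK) ↔ ∃ w ∈ D.sosCone e, D.restrict w = c := by
  constructor
  · intro hc
    induction hc using Submodule.span_induction with
    | mem c hc =>
      obtain ⟨i, _, q, hq, _, rfl⟩ := hc
      exact ⟨_, mul_weight_mem_sosCone (isSOSOfDegree_mul_self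
        ((mem_restrictTotalDegree _ _ _).1 hq)), rfl⟩
    | zero => exact ⟨0, zero_mem _, map_zero _⟩
    | add _ _ _ _ h h' =>
      obtain ⟨w, hw, rfl⟩ := h
      obtain ⟨w', hw', rfl⟩ := h'
      exact ⟨w + w', add_mem hw hw', map_add _ _ _⟩
    | smul r _ _ h =>
      obtain ⟨w, hw, rfl⟩ := h
      exact ⟨r.1 • w, PointedCone.smul_mem _ r.2 hw, map_smul _ _ _⟩
  · rintro ⟨w, hw, rfl⟩
    refine sosCone_induction
      (motive := fun w => D.restrict w ∈ PointedCone.hull ℝ (D.generators e hK)) (by simp)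
      (fun v w hv hw => ?_) (fun i q hq => ?_) hw
    · rw [map_add]
      exact add_mem hv hw
    · by_cases hi : D.weight i = 0
      · simp [hi]
      -- If q vanishes on K the term contributes nothing; otherwise q is divided by its norm.
      rcases eq_or_ne (D.restrict q) 0 with h0 | h0
      · simp [h0]
      have hn : ‖D.restrict q‖ ≠ 0 := norm_ne_zero_iff.2 h0
      have : D.restrict (q * q * D.weight i) = ‖D.restrict q‖ ^ 2 •
          D.restrict ((‖D.restrict q‖⁻¹ • q) * (‖D.restrict q‖⁻¹ • q) * D.weight i) := by
        rw [← map_smul]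
        congr 1
        simp only [smul_mul_assoc, mul_smul_comm, smul_smul]
        field_simp
        simp
      rw [this]
      refine PointedCone.smul_mem _ (sq_nonneg _) (PointedCone.subset_hull
        ⟨i, hi, _, Submodule.smul_mem _ _ ((mem_restrictTotalDegree _ _ _).2 hq), ?_, rfl⟩)
      rw [map_smul, norm_smul, norm_inv, norm_norm, inv_mul_cancel₀ hn]

/-! ### Existence of an optimal solution of the SOS problem -/

theorem eval_nonneg_of_mem_generators {hK : CompactSpace D.feasibleSet} {c : C(D.feasibleSet, ℝ)}
    (hc : c ∈ D.generators e hK) (z : D.feasibleSet) : 0 ≤ c z := by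
  obtain ⟨w, hw, rfl⟩ := (mem_hull_generators_iff hK).1 (PointedCone.subset_hull hc)
  exact eval_nonneg_of_mem_sosCone hw z.2

theorem isIndepOf_weight (i : Option (Fin na ⊕ Fin nb)) (k : Fin m) :
    IsIndepOf (Sum.inr (Sum.inr k)) (D.weight i) := by
  rcases i with _ | i | j
  · simpa [weight] using isIndepOf_C _ 1
  · exact isIndepOf_ofU _ _
  · exact isIndepOf_ofX _ _

theorem fiberIntegral_nonneg {hK : CompactSpace D.feasibleSet} (hBc : IsCompact D.B) (y : D.fiber)
    {c : C(D.feasibleSet, ℝ)} (hc : c ∈ D.generators e hK) : 0 ≤ fiberIntegral hK hBc y c :=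
  integral_nonneg fun _ => eval_nonneg_of_mem_generators hc _

/-- A generator q²w has q nonzero on K, so 1 - vᵀv does not divide q. By `sphere_dvd`, wq is nonzero
at some point over the interior of B. On that fiber the integrand is continuous, nonnegative, and
positive near an interior point. -/
theorem exists_fiberIntegral_pos (hm : 0 < m) (hU : (interior D.U).Nonempty)
    (hB : (interior D.B).Nonempty) (hBball : ∃ j R, D.b j = ballPoly n R)
    {hK : CompactSpace D.feasibleSet} {c : C(D.feasibleSet, ℝ)} (hc : c ∈ D.generators e hK) :
    ∃ y, 0 < fiberIntegral hK (isCompact_B hBball) y c := by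
  have hnonneg := eval_nonneg_of_mem_generators hc
  obtain ⟨i, hi, q, hq, hq1, rfl⟩ := hc
  have hne : ¬ sphere n p m ∣ q := by
    rintro ⟨r, rfl⟩
    rw [map_mul, restrict_sphere, zero_mul, norm_zero] at hq1
    exact zero_ne_one hq1
  have h := mt (sphere_dvd hm hU hB (fun k => isIndepOf_weight i k) hi) hne
  push Not at h
  obtain ⟨x₀, hx₀, y, hy, hxy⟩ := h
  refine ⟨⟨y, hy⟩, ?_⟩
  rw [fiberIntegral_restrict]
  set F : (Fin n → ℝ) → ℝ := fun x =>
    eval (Sum.elim x (Sum.elim y.1 y.2)) (q * q * D.weight i) with hF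
  have hFc : Continuous F := (MvPolynomial.continuous_eval _).comp
    (continuous_sumElim continuous_id continuous_const)
  have hF0 : ∀ x ∈ D.B, 0 ≤ F x := fun x hx =>
    hnonneg ⟨_, mem_feasibleSet_iff.2 ⟨hx, hy⟩⟩
  have hBm := (isCompact_B hBball).measurableSet
  change 0 < ∫ x in D.B, F x
  rw [setIntegral_pos_iff_support_of_nonneg_ae
    ((ae_restrict_iff' hBm).2 (Filter.Eventually.of_forall hF0))
    (hFc.continuousOn.integrableOn_compact (isCompact_B hBball))]
  have hopen : IsOpen (Function.support F ∩ interior D.B) :=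
    hFc.isOpen_support.inter isOpen_interior
  refine (hopen.measure_pos volume ⟨x₀, ?_, hx₀⟩).trans_le
    (measure_mono (Set.inter_subset_inter_right _ interior_subset))
  rw [Function.mem_support, hF]
  simp only [map_mul] at hxy ⊢
  rw [mul_ne_zero_iff] at hxy
  exact mul_ne_zero (mul_ne_zero hxy.2 hxy.2) hxy.1

theorem exists_SOSFeasible {d : ℕ} (hd : 1 ≤ d) (hdP : 2 + D.degP ≤ 2 * d)
    (hUball : ∃ i R, D.a i = ballPoly p R) (hBball : ∃ j R, D.b j = ballPoly n R)
    (he : D.Admissible d e) : ∃ g, D.SOSFeasible d e g := by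
  obtain ⟨N, hN⟩ := exists_add_mem_truncModule hd hUball hBball (totalDegree_quadForm_le.trans hdP)
  refine ⟨C (-N), sosFeasible_iff.2 ⟨by rw [totalDegree_C]; omega, he.truncModule_le ?_⟩⟩
  convert hN using 1
  simp [ofX]
  ring

theorem Admissible.exists_SOSOptimal {d : ℕ} (hm : 0 < m) (hd : 1 ≤ d) (hdP : 2 + D.degP ≤ 2 * d)
    (hUball : ∃ i R, D.a i = ballPoly p R) (hBball : ∃ j R, D.b j = ballPoly n R)
    (hU : (interior D.U).Nonempty) (hB : (interior D.B).Nonempty)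
    (he : D.Admissible d e) : ∃ g, D.SOSOptimal d e g := by
  have hK : CompactSpace D.feasibleSet :=
    isCompact_iff_compactSpace.1 (isCompact_feasibleSet hUball hBball)
  have hBc := isCompact_B hBball
  have : Nonempty D.fiber := (fiber_nonempty hm (hU.mono interior_subset)).to_subtype
  obtain ⟨I, hI, hpos⟩ := exists_finset_sum_pos (isCompact_generators (e := e) hK)
    (fiberIntegral hK hBc) (fun y c hc => fiberIntegral_nonneg hBc y hc)
    (fun c hc => exists_fiberIntegral_pos hm hU hB hBball hc)
  set ℓ : C(D.feasibleSet, ℝ) →L[ℝ] ℝ := ∑ y ∈ I, fiberIntegral hK hBc y with hℓ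
  have hℓpos : ∀ c ∈ D.generators e hK, 0 < ℓ c := fun c hc => by
    simpa [hℓ] using hpos c hc
  have hℓX : ∀ g : MvPolynomial (Fin n) ℝ, ℓ (D.restrict (ofX g)) = I.card * D.objective g := by
    intro g
    simp [hℓ, fiberIntegral_ofX]
  -- the restrictions of `ofX g`, `deg g ≤ 2d`
  set G : Submodule ℝ C(D.feasibleSet, ℝ) := Submodule.map
    (D.restrict.comp (rename Sum.inl)).toLinearMap (restrictTotalDegree (Fin n) ℝ (2 * d)) with hG
  have hGclosed : IsClosed {c | D.restrict D.quadForm - c ∈ G} :=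
    (Submodule.closed_of_finiteDimensional G).preimage (by fun_prop)
  obtain ⟨g₀, hg₀⟩ := exists_SOSFeasible hd hdP hUball hBball he
  have hfeas : ∀ g, D.SOSFeasible d e g → D.restrict (D.quadForm - ofX g) ∈
      PointedCone.hull ℝ (D.generators e hK) ∧
      D.restrict D.quadForm - D.restrict (D.quadForm - ofX g) ∈ G := by
    intro g hg
    obtain ⟨hgd, r, c, hr, hc, h⟩ := sosFeasible_iff.1 hg
    refine ⟨(mem_hull_generators_iff hK).2 ⟨c, hc, ?_⟩, g,
      (mem_restrictTotalDegree _ _ _).2 hgd, ?_⟩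
    · rw [h, map_add, map_mul, restrict_sphere, mul_zero, zero_add]
    · rw [← map_sub, sub_sub_cancel]
      rfl
  -- The value of one feasible point serves as cutoff: only the compact slice below it can contain
  -- minimizers.
  set M := ℓ (D.restrict (D.quadForm - ofX g₀))
  have hcompact := (isCompact_hull_inter_le (isCompact_generators (e := e) hK)
    (he.generators_subset hK) ℓ hℓpos M).inter_right hGclosed
  obtain ⟨c, ⟨⟨hc, hcM⟩, g, hg, hgc⟩, hmin⟩ := hcompact.exists_isMinOn
    ⟨_, ⟨(hfeas g₀ hg₀).1, le_rfl⟩, (hfeas g₀ hg₀).2⟩ ℓ.continuous.continuousOn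
  obtain ⟨w, hw, rfl⟩ := (mem_hull_generators_iff hK).1 hc
  replace hg : g.totalDegree ≤ 2 * d := (mem_restrictTotalDegree _ _ _).1 hg
  replace hgc : D.restrict (ofX g) = D.restrict D.quadForm - D.restrict w := hgc
  have hvanish : D.restrict (D.quadForm - ofX g - w) = 0 := by
    rw [map_sub, map_sub, hgc]
    abel
  obtain ⟨r, hr⟩ := sphere_dvd_of_restrict_eq_zero hm hU hB hvanish
  -- Degrees add in products, so deg r = deg(f - g - w) - 2, and f, g, w all have degree at most
  -- 2e.r + 2.
  have hrdeg : r.totalDegree ≤ 2 * e.r := by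
    rcases eq_or_ne r 0 with rfl | hr0
    · simp
    have h1 := congrArg totalDegree hr
    rw [totalDegree_mul_of_isDomain (sphere_ne_zero hm) hr0, totalDegree_sphere hm] at h1
    have h2 := totalDegree_sub (D.quadForm - ofX g) w
    have h3 := totalDegree_sub D.quadForm (ofX g)
    have h4 := D.totalDegree_quadForm_le
    have h5 := totalDegree_ofX_le (p := p) (m := m) g
    have h6 := he.totalDegree_le_of_mem_sosCone hw
    have h7 : d - 1 ≤ e.r := he.r_ge
    omega
  refine ⟨g, sosFeasible_iff.2 ⟨hg, r, w, hrdeg, hw, by rw [mul_comm, ← hr]; ring⟩, ?_⟩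
  intro g' hg'
  have hcard : (0 : ℝ) < I.card := by exact_mod_cast hI.card_pos
  have hobj : ∀ g, ℓ (D.restrict (D.quadForm - ofX g)) =
      ℓ (D.restrict D.quadForm) - I.card * D.objective g := fun g => by
    rw [map_sub, map_sub, hℓX]
  have hw' : ℓ (D.restrict w) = ℓ (D.restrict (D.quadForm - ofX g)) := by
    rw [map_sub, hgc, sub_sub_cancel]
  by_cases hM : ℓ (D.restrict (D.quadForm - ofX g')) ≤ M
  · have := hmin (a := D.restrict (D.quadForm - ofX g')) ⟨⟨(hfeas g' hg').1, hM⟩, (hfeas g' hg').2⟩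
    simp only [Set.mem_ofPred_eq] at this
    rw [hw', hobj, hobj] at this
    nlinarith
  · have : ℓ (D.restrict w) < ℓ (D.restrict (D.quadForm - ofX g')) :=
      hcM.trans_lt (not_le.1 hM)
    rw [hw', hobj, hobj] at this
    nlinarith

end PMIData

/-! ### Riesz functionals and localizing matrices -/

section Riesz

variable {σ : Type*}

/-- The Riesz functional as a linear map. -/
noncomputable def rieszLinear (y : (σ →₀ ℕ) → ℝ) : MvPolynomial σ ℝ →ₗ[ℝ] ℝ :=
  (basisMonomials σ ℝ).constr ℝ y

theorem rieszLinear_monomial (y : (σ →₀ ℕ) → ℝ) (γ : σ →₀ ℕ) (c : ℝ) :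
    rieszLinear y (monomial γ c) = c * y γ := by
  have h : (monomial γ c : MvPolynomial σ ℝ) = c • basisMonomials σ ℝ γ := by
    simp [smul_monomial]
  rw [h, map_smul, rieszLinear, Module.Basis.constr_basis, smul_eq_mul]

theorem rieszFunctional_eq (y : (σ →₀ ℕ) → ℝ) (f : MvPolynomial σ ℝ) :
    rieszFunctional y f = rieszLinear y f := by
  conv_rhs => rw [← support_sum_monomial_coeff f]
  rw [rieszFunctional, map_sum]
  exact Finset.sum_congr rfl fun γ _ => (rieszLinear_monomial y γ _).symm

theorem rieszLinear_of_linear (L : MvPolynomial σ ℝ →ₗ[ℝ] ℝ) :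
    rieszLinear (fun γ => L (monomial γ 1)) = L := by
  refine (basisMonomials σ ℝ).ext fun γ => ?_
  rw [rieszLinear, Module.Basis.constr_basis, coe_basisMonomials]

theorem sum_monomial_of_totalDegree_le {k : ℕ} [Fintype {α : σ →₀ ℕ // α.degree ≤ k}]
    {q : MvPolynomial σ ℝ} (hq : q.totalDegree ≤ k) :
    ∑ α : {α : σ →₀ ℕ // α.degree ≤ k}, monomial α.1 (coeff α.1 q) = q := by
  classical
  ext γ
  rw [coeff_sum]
  simp only [coeff_monomial]
  by_cases hγ : γ.degree ≤ k
  · rw [Finset.sum_eq_single ⟨γ, hγ⟩]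
    · simp
    · intro β _ hβ
      exact if_neg fun h => hβ (Subtype.ext h)
    · simp
  · rw [Finset.sum_eq_zero]
    · by_contra h
      exact hγ ((le_totalDegree (mem_support_iff.2 (Ne.symm h))).trans hq)
    · rintro ⟨β, hβ⟩ -
      exact if_neg fun h => hγ ((congrArg Finsupp.degree h).symm.trans_le hβ)

theorem quadForm_localizingMatrix {k : ℕ} (h : MvPolynomial σ ℝ) (y : (σ →₀ ℕ) → ℝ)
    (ξ : {α : σ →₀ ℕ // α.degree ≤ k} →₀ ℝ) :
    (ξ.sum fun α a => ξ.sum fun β b => star a * localizingMatrix k h y α β * b) =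
      rieszLinear y ((ξ.sum fun α a => monomial α.1 a) * (ξ.sum fun α a => monomial α.1 a) * h) := by
  simp only [Finsupp.sum, Finset.sum_mul, Finset.mul_sum, map_sum, star_trivial,
    localizingMatrix, rieszFunctional_eq]
  refine Finset.sum_congr rfl fun α _ => Finset.sum_congr rfl fun β _ => ?_
  have : monomial α.1 (ξ α) * monomial β.1 (ξ β) * h =
      (ξ α * ξ β) • (h * monomial (α.1 + β.1) 1) := by
    rw [monomial_mul, mul_comm, ← mul_smul_comm, smul_monomial, smul_eq_mul, mul_one]
  rw [mul_comm (monomial β.1 _), this, map_smul, smul_eq_mul]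
  ring

/-- A localizing matrix is positive semidefinite iff the Riesz functional is nonnegative on
weighted squares. -/
theorem posSemidef_localizingMatrix_iff [Finite σ] {k : ℕ} {h : MvPolynomial σ ℝ}
    {y : (σ →₀ ℕ) → ℝ} :
    (localizingMatrix k h y).PosSemidef ↔
      ∀ q : MvPolynomial σ ℝ, q.totalDegree ≤ k → 0 ≤ rieszLinear y (q * q * h) := by
  have : Fintype {α : σ →₀ ℕ // α.degree ≤ k} := (Finsupp.finite_of_degree_le k).fintype
  constructor
  · rintro ⟨-, hy⟩ q hq
    have hsum : ((Finsupp.equivFunOnFinite.symm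
        fun α : {α : σ →₀ ℕ // α.degree ≤ k} => coeff α.1 q).sum
          fun α a => monomial α.1 a) = q := by
      rw [Finsupp.sum_fintype _ _ fun _ => monomial_zero]
      exact sum_monomial_of_totalDegree_le hq
    have := hy (Finsupp.equivFunOnFinite.symm fun α => coeff α.1 q)
    rwa [quadForm_localizingMatrix, hsum] at this
  · intro hy
    refine ⟨?_, fun ξ => ?_⟩
    · ext α β
      simp [localizingMatrix, add_comm]
    · rw [quadForm_localizingMatrix]
      exact hy _ (totalDegree_finsetSum_le fun α _ => (totalDegree_monomial_le _ _).trans α.2)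

theorem rieszLinear_nonneg_of_posSemidef [Finite σ] {k : ℕ} {h s : MvPolynomial σ ℝ}
    {y : (σ →₀ ℕ) → ℝ} (hy : (localizingMatrix k h y).PosSemidef) (hs : IsSOSOfDegree k s) :
    0 ≤ rieszLinear y (s * h) := by
  refine hs.induction (motive := fun s => 0 ≤ rieszLinear y (s * h)) (by simp) fun q s hq hs => ?_
  rw [add_mul, map_add]
  exact add_nonneg (posSemidef_localizingMatrix_iff.1 hy q hq) hs

/-- Every monomial of degree at most 2k is a product of two of degree at most k, hence appears as an
entry of the matrix. -/
theorem rieszLinear_mul_eq_zero {k : ℕ} {h r : MvPolynomial σ ℝ}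
    {y : (σ →₀ ℕ) → ℝ} (hy : localizingMatrix k h y = 0) (hr : r.totalDegree ≤ 2 * k) :
    rieszLinear y (r * h) = 0 := by
  rw [← support_sum_monomial_coeff r, Finset.sum_mul, map_sum]
  refine Finset.sum_eq_zero fun γ hγ => ?_
  have hγd : γ.degree ≤ 2 * k := (le_totalDegree hγ).trans hr
  obtain ⟨α, hα, hαd⟩ := Finsupp.exists_le_degree_eq γ (min k γ.degree) (min_le_right _ _)
  obtain ⟨β, rfl⟩ := exists_add_of_le hα
  rw [map_add] at hγd hαd
  have h0 := congrFun (congrFun hy ⟨α, by omega⟩) ⟨β, by omega⟩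
  rw [localizingMatrix, rieszFunctional_eq] at h0
  have : monomial (α + β) (coeff (α + β) r) * h =
      coeff (α + β) r • (h * monomial (α + β) 1) := by
    rw [mul_comm, ← mul_smul_comm, smul_monomial, smul_eq_mul, mul_one]
  rw [this, map_smul]
  simp only at h0
  rw [h0]
  simp

end Riesz

/-! ### Moment sequences as functionals nonnegative on the module; weak duality -/

namespace PMIData

variable {n p m na nb : ℕ} {D : PMIData n p m na nb} {e : SOSDegrees na nb}

theorem objective_monomial (α : Fin n →₀ ℕ) (c : ℝ) :
    D.objective (monomial α c) = c * ∫ x in D.B, ∏ i, x i ^ α i := by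
  simp only [objective, eval_monomial, Finsupp.prod_fintype _ _ fun _ => pow_zero _]
  exact integral_const_mul c _

theorem MomentFeasible.rieszLinear_ofX (hBball : ∃ j R, D.b j = ballPoly n R) {d : ℕ}
    {y : (Fin n ⊕ Fin p ⊕ Fin m →₀ ℕ) → ℝ} (hy : D.MomentFeasible d y)
    {g : MvPolynomial (Fin n) ℝ} (hg : g.totalDegree ≤ 2 * d) :
    rieszLinear y (ofX g) = D.objective g := by
  have hobj : D.objective g = ∑ α ∈ g.support, D.objective (monomial α (coeff α g)) := by
    conv_lhs => rw [← support_sum_monomial_coeff g]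
    simp only [objective, map_sum]
    exact integral_finsetSum _ fun α _ => integrableOn_eval hBball _
  have hX : (ofX g : MvPolynomial (Fin n ⊕ Fin p ⊕ Fin m) ℝ) =
      ∑ α ∈ g.support, coeff α g • ofX (monomial α 1) := by
    conv_lhs => rw [← support_sum_monomial_coeff g]
    simp only [ofX, map_sum, ← map_smul, smul_eq_mul, mul_one]
  rw [hobj, hX, map_sum]
  refine Finset.sum_congr rfl fun α hα => ?_
  rw [map_smul, ← rieszFunctional_eq, hy.marginal α ((le_totalDegree hα).trans hg),
    objective_monomial, smul_eq_mul]

theorem MomentFeasible.rieszLinear_nonneg {d : ℕ} {y : (Fin n ⊕ Fin p ⊕ Fin m →₀ ℕ) → ℝ}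
    (hy : D.MomentFeasible d y) {w : MvPolynomial (Fin n ⊕ Fin p ⊕ Fin m) ℝ}
    (hw : w ∈ D.truncModule (D.lowestDegrees d)) : 0 ≤ rieszLinear y w := by
  obtain ⟨r, c, hr, ⟨s₀, s, t, h₀, hs, ht, rfl⟩, rfl⟩ := hw
  rw [map_add, rieszLinear_mul_eq_zero hy.sphere hr, zero_add, map_add, map_add, map_sum, map_sum]
  refine add_nonneg (add_nonneg ?_ ?_) ?_
  · simpa using rieszLinear_nonneg_of_posSemidef hy.moment h₀
  · exact Finset.sum_nonneg fun i _ => rieszLinear_nonneg_of_posSemidef (hy.loc_a i) (hs i)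
  · exact Finset.sum_nonneg fun j _ => rieszLinear_nonneg_of_posSemidef (hy.loc_b j) (ht j)

/-- Weak duality. -/
theorem objective_le_rieszFunctional (hBball : ∃ j R, D.b j = ballPoly n R) {d : ℕ}
    {y : (Fin n ⊕ Fin p ⊕ Fin m →₀ ℕ) → ℝ} (hy : D.MomentFeasible d y)
    {g : MvPolynomial (Fin n) ℝ} (hg : D.SOSFeasible d (D.lowestDegrees d) g) :
    D.objective g ≤ rieszFunctional y D.quadForm := by
  obtain ⟨hgd, hg⟩ := sosFeasible_iff.1 hg
  have := hy.rieszLinear_nonneg hg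
  rw [map_sub, hy.rieszLinear_ofX hBball hgd] at this
  rw [rieszFunctional_eq]
  linarith

theorem momentFeasible_of_linear {d : ℕ} (L : MvPolynomial (Fin n ⊕ Fin p ⊕ Fin m) ℝ →ₗ[ℝ] ℝ)
    (hL : ∀ w ∈ D.truncModule (D.lowestDegrees d), 0 ≤ L w)
    (hX : ∀ g : MvPolynomial (Fin n) ℝ, g.totalDegree ≤ 2 * d → L (ofX g) = D.objective g) :
    D.MomentFeasible d fun γ => L (monomial γ 1) where
  moment := by
    rw [posSemidef_localizingMatrix_iff, rieszLinear_of_linear]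
    intro q hq
    rw [mul_one]
    exact hL _ (sosCone_le_truncModule (mem_sosCone_of_isSOS (isSOSOfDegree_mul_self hq)))
  sphere := by
    ext α β
    rw [localizingMatrix, rieszFunctional_eq, rieszLinear_of_linear, mul_comm]
    have hdeg : ∀ c : ℝ, (monomial (α.1 + β.1) c :
        MvPolynomial (Fin n ⊕ Fin p ⊕ Fin m) ℝ).totalDegree ≤ 2 * (d - 1) := by
      intro c
      refine (totalDegree_monomial_le _ _).trans ?_
      change (α.1 + β.1).degree ≤ _
      rw [map_add]
      have := α.2
      have := β.2
      omega
    -- The multiplier of the sphere is unrestricted in sign, so nonnegativity for both signs forces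
    -- equality.
    have h1 := hL _ (mul_sphere_mem_truncModule (D := D) (e := D.lowestDegrees d) (hdeg 1))
    have h2 := hL _ (mul_sphere_mem_truncModule (D := D) (e := D.lowestDegrees d) (hdeg (-1)))
    rw [map_neg, neg_mul, map_neg] at h2
    simp only [Matrix.zero_apply]
    linarith
  loc_a i := by
    rw [posSemidef_localizingMatrix_iff, rieszLinear_of_linear]
    intro q hq
    exact hL _ (sosCone_le_truncModule (mul_ofU_mem_sosCone (isSOSOfDegree_mul_self hq)))
  loc_b j := by
    rw [posSemidef_localizingMatrix_iff, rieszLinear_of_linear]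
    intro q hq
    exact hL _ (sosCone_le_truncModule (mul_ofX_mem_sosCone (isSOSOfDegree_mul_self hq)))
  marginal α hα := by
    rw [rieszFunctional_eq, rieszLinear_of_linear, hX _ ((totalDegree_monomial_le _ _).trans hα),
      objective_monomial, one_mul]

/-! ### Strong duality -/

theorem exists_truncation {σ : Type*} (k : ℕ) (w : MvPolynomial σ ℝ) :
    ∃ w' : MvPolynomial σ ℝ, w'.totalDegree ≤ k ∧ ∀ γ, γ.degree ≤ k → coeff γ w' = coeff γ w := by
  refine ⟨∑ i ∈ Finset.range (k + 1), homogeneousComponent i w, ?_, fun γ hγ => ?_⟩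
  · refine totalDegree_finsetSum_le fun i hi => ?_
    have := (homogeneousComponent_isHomogeneous i w).totalDegree_le
    have := Finset.mem_range.1 hi
    omega
  · rw [coeff_sum]
    simp only [coeff_homogeneousComponent]
    rw [Finset.sum_ite_eq, if_pos (Finset.mem_range.2 (by omega))]

theorem eq_of_coeff_eq_of_totalDegree_le {σ : Type*} {k : ℕ} {v w : MvPolynomial σ ℝ}
    (hv : v.totalDegree ≤ k) (hw : w.totalDegree ≤ k)
    (h : ∀ γ, γ.degree ≤ k → coeff γ v = coeff γ w) : v = w := by
  ext γ
  by_cases hγ : γ.degree ≤ k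
  · exact h γ hγ
  · rw [not_le] at hγ
    rw [coeff_eq_zero_of_totalDegree_lt (hv.trans_lt hγ),
      coeff_eq_zero_of_totalDegree_lt (hw.trans_lt hγ)]

/-- Polynomials that agree up to degree `k` with an element of a cone. -/
def _root_.PointedCone.upToDegree {σ : Type*} (T : PointedCone ℝ (MvPolynomial σ ℝ)) (k : ℕ) :
    PointedCone ℝ (MvPolynomial σ ℝ) where
  carrier := {w | ∃ c ∈ T, ∀ γ, γ.degree ≤ k → coeff γ w = coeff γ c}
  zero_mem' := ⟨0, zero_mem _, fun _ _ => rfl⟩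
  add_mem' := by
    rintro v w ⟨c, hc, h⟩ ⟨c', hc', h'⟩
    exact ⟨c + c', add_mem hc hc', fun γ hγ => by rw [coeff_add, coeff_add, h γ hγ, h' γ hγ]⟩
  smul_mem' := by
    rintro r w ⟨c, hc, h⟩
    refine ⟨r.1 • c, PointedCone.smul_mem _ r.2 hc, fun γ hγ => ?_⟩
    change coeff γ (r.1 • w) = _
    rw [coeff_smul, coeff_smul, h γ hγ]

/-- The partially defined functional `ofX g ↦ ∫_B g`. -/
noncomputable def marginalFunctional (hBball : ∃ j R, D.b j = ballPoly n R) (d : ℕ) :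
    MvPolynomial (Fin n ⊕ Fin p ⊕ Fin m) ℝ →ₗ.[ℝ] ℝ where
  domain := Submodule.map (rename Sum.inl).toLinearMap (restrictTotalDegree (Fin n) ℝ (2 * d))
  toFun :=
    -- Elements of the domain involve x only, so substituting u = v = 0 changes nothing and makes
    -- linearity evident without choosing g.
    { toFun := fun w => ∫ x in D.B, eval (Sum.elim x 0) w.1
      map_add' := fun v w => by
        have hint : ∀ w : MvPolynomial (Fin n ⊕ Fin p ⊕ Fin m) ℝ,
            IntegrableOn (fun x => eval (Sum.elim x 0) w) D.B := fun w =>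
          ((MvPolynomial.continuous_eval w).comp (continuous_sumElim continuous_id
            continuous_const)).continuousOn.integrableOn_compact (isCompact_B hBball)
        simp only [Submodule.coe_add, map_add]
        exact integral_add (hint _) (hint _)
      map_smul' := fun r w => by
        simp only [Submodule.coe_smul, smul_eval]
        exact integral_const_mul r _ }

/-- Strong duality: the optimal value of the SOS problem is attained by a moment sequence. -/
theorem exists_momentFeasible_le {d : ℕ} (hm : 0 < m) (hd : 1 ≤ d) (hdP : 2 + D.degP ≤ 2 * d)
    (hUball : ∃ i R, D.a i = ballPoly p R) (hBball : ∃ j R, D.b j = ballPoly n R)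
    (hU : D.U.Nonempty) (hB : (interior D.B).Nonempty)
    (he : D.Admissible d (D.lowestDegrees d)) {g : MvPolynomial (Fin n) ℝ}
    (hg : D.SOSOptimal d (D.lowestDegrees d) g) :
    ∃ y, D.MomentFeasible d y ∧ rieszFunctional y D.quadForm ≤ D.objective g := by
  have hBc := isCompact_B hBball
  have hvol : 0 < volume.real D.B := by
    refine ENNReal.toReal_pos ?_ hBc.measure_lt_top.ne
    exact ((isOpen_interior.measure_pos volume hB).trans_le (measure_mono interior_subset)).ne'
  have hobjC : ∀ c : ℝ, D.objective (C c) = volume.real D.B * c := by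
    intro c
    simp [objective]
  have hobj_sub : ∀ f h, D.objective (f - h) = D.objective f - D.objective h := by
    intro f h
    simp only [objective, map_sub]
    exact integral_sub (integrableOn_eval hBball _) (integrableOn_eval hBball _)
  have hobj_smul : ∀ (r : ℝ) h, D.objective (r • h) = r * D.objective h := by
    intro r h
    simp only [objective, smul_eval]
    exact integral_const_mul r _
  -- The constant with the same integral over B as g; then L(c₀ - f) ≥ 0 says that L(f) is at most
  -- the SOS optimum.
  set c₀ : ℝ := D.objective g / volume.real D.B with hc₀
  have hc₀' : D.objective (C c₀) = D.objective g := by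
    rw [hobjC, hc₀]
    field_simp
  -- the quadratic module, enlarged by the constraint `L f ≤ c₀`
  set T : PointedCone ℝ (MvPolynomial (Fin n ⊕ Fin p ⊕ Fin m) ℝ) :=
    D.truncModule (D.lowestDegrees d) ⊔ PointedCone.hull ℝ {C c₀ - D.quadForm} with hT
  have hmemT : ∀ w ∈ T, ∃ c ∈ D.truncModule (D.lowestDegrees d), ∃ t : ℝ, 0 ≤ t ∧
      w = c + t • (C c₀ - D.quadForm) := by
    intro w hw
    obtain ⟨c, hc, b, hb, rfl⟩ := Submodule.mem_sup.1 hw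
    obtain ⟨t, rfl⟩ := Submodule.mem_span_singleton.1 hb
    exact ⟨c, hc, t.1, t.2, rfl⟩
  have hfdeg := D.totalDegree_quadForm_le.trans hdP
  have hmoddeg : ∀ c ∈ D.truncModule (D.lowestDegrees d), c.totalDegree ≤ 2 * d := by
    intro c hc
    have := he.totalDegree_le_of_mem_truncModule hc
    simp only [lowestDegrees] at this
    omega
  -- The extension theorem needs an order unit for all polynomials; ignoring coefficients above
  -- degree 2d reduces this to the degree-bounded Archimedean property.
  obtain ⟨L, hLX, hLT⟩ := riesz_extension (T.upToDegree (2 * d))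
    (marginalFunctional (p := p) (m := m) hBball d) (by
      rintro ⟨_, h, hh, rfl⟩ ⟨w, hw, hcoeff⟩
      obtain ⟨c, hc, t, ht, rfl⟩ := hmemT w hw
      replace hh : h.totalDegree ≤ 2 * d := (mem_restrictTotalDegree _ _ _).1 hh
      have heq : ofX h = c + t • (C c₀ - D.quadForm) := by
        refine eq_of_coeff_eq_of_totalDegree_le ((totalDegree_ofX_le h).trans hh) ?_ hcoeff
        refine (totalDegree_add _ _).trans (max_le (hmoddeg c hc) ?_)
        refine (totalDegree_smul_le _ _).trans ((totalDegree_sub _ _).trans (max_le ?_ hfdeg))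
        simp
      have hval : marginalFunctional hBball d ⟨ofX h, h, (mem_restrictTotalDegree _ _ _).2 hh, rfl⟩ =
          D.objective h := by
        change ∫ x in D.B, eval (Sum.elim x 0) (ofX h) = _
        simp only [eval_ofX, Sum.elim_inl]
        rfl
      refine hval.symm ▸ ?_
      -- If t = 0, h lies in the module and is nonnegative on B. If t > 0, c₀ - h/t is feasible, and
      -- optimality of g gives ∫h ≥ 0.
      rcases ht.eq_or_lt with rfl | ht
      · rw [zero_smul, add_zero] at heq
        obtain ⟨⟨u, v⟩, huv⟩ := fiber_nonempty hm hU
        refine setIntegral_nonneg hBc.measurableSet fun x hx => ?_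
        have := eval_nonneg_of_mem_truncModule (heq ▸ hc) (mem_feasibleSet_iff.2 ⟨hx, huv⟩)
        rwa [eval_ofX] at this
      · have hfeas : D.SOSFeasible d (D.lowestDegrees d) (C c₀ - t⁻¹ • h) := by
          refine sosFeasible_iff.2 ⟨(totalDegree_sub _ _).trans
            (max_le (by simp) ((totalDegree_smul_le _ _).trans hh)), ?_⟩
          have : D.quadForm - ofX (C c₀ - t⁻¹ • h) = t⁻¹ • c := by
            have h1 : (ofX (C c₀ - t⁻¹ • h) : MvPolynomial (Fin n ⊕ Fin p ⊕ Fin m) ℝ) =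
                C c₀ - t⁻¹ • ofX h := by simp [ofX]
            rw [h1, heq, smul_add, smul_smul, inv_mul_cancel₀ ht.ne', one_smul]
            ring
          rw [this]
          exact PointedCone.smul_mem _ (inv_nonneg.2 ht.le) hc
        have := hg.2 _ hfeas
        rw [hobj_sub, hc₀', hobj_smul] at this
        have h2 : 0 ≤ t⁻¹ * D.objective h := by linarith
        exact nonneg_of_mul_nonneg_right h2 (inv_pos.2 ht))
    (by
      intro w
      obtain ⟨w', hw', hcoeff⟩ := exists_truncation (2 * d) w
      obtain ⟨N, hN⟩ := exists_add_mem_truncModule hd hUball hBball hw'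
      refine ⟨⟨C N, C N, (mem_restrictTotalDegree _ _ _).2 (by simp), by simp⟩, C N + w', ?_, fun γ hγ => ?_⟩
      · exact (le_sup_left : D.truncModule (D.lowestDegrees d) ≤ T) hN
      · rw [coeff_add, coeff_add, hcoeff γ hγ])
  have hLT' : ∀ w ∈ T, 0 ≤ L w := fun w hw => hLT w ⟨w, hw, fun _ _ => rfl⟩
  have hLobj : ∀ h : MvPolynomial (Fin n) ℝ, h.totalDegree ≤ 2 * d →
      L (ofX h) = D.objective h := by
    intro h hh
    refine (hLX ⟨ofX h, h, (mem_restrictTotalDegree _ _ _).2 hh, rfl⟩).trans ?_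
    change ∫ x in D.B, eval (Sum.elim x 0) (ofX h) = _
    simp only [eval_ofX, Sum.elim_inl]
    rfl
  have hle₁ : D.truncModule (D.lowestDegrees d) ≤ T := le_sup_left
  have hle₂ : PointedCone.hull ℝ {C c₀ - D.quadForm} ≤ T := le_sup_right
  refine ⟨_, momentFeasible_of_linear L (fun w hw => hLT' w (hle₁ hw)) hLobj, ?_⟩
  rw [rieszFunctional_eq, rieszLinear_of_linear]
  have h1 := hLT' (C c₀ - D.quadForm) (hle₂ (PointedCone.subset_hull rfl))
  have h2 := hLobj (C c₀) (by simp)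
  rw [hc₀', ofX, rename_C] at h2
  rw [map_sub, h2] at h1
  linarith

/-! ### Values of the problems -/

theorem SOSOptimal.sosValue_eq {d : ℕ} {g : MvPolynomial (Fin n) ℝ} (hg : D.SOSOptimal d e g) :
    D.sosValue d e = (∫ x in D.B, D.robustMinEig x) - D.objective g := by
  have : IsGreatest {c | ∃ g, D.SOSFeasible d e g ∧ c = D.objective g} (D.objective g) :=
    ⟨⟨g, hg.1, rfl⟩, by rintro _ ⟨g', hg', rfl⟩; exact hg.2 g' hg'⟩
  rw [sosValue, this.csSup_eq]

theorem MomentOptimal.momentValue_eq {d : ℕ} {y : (Fin n ⊕ Fin p ⊕ Fin m →₀ ℕ) → ℝ}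
    (hy : D.MomentOptimal d y) :
    D.momentValue d = (∫ x in D.B, D.robustMinEig x) - rieszFunctional y D.quadForm := by
  have : IsLeast {c | ∃ y, D.MomentFeasible d y ∧ c = rieszFunctional y D.quadForm}
      (rieszFunctional y D.quadForm) :=
    ⟨⟨y, hy.1, rfl⟩, by rintro _ ⟨y', hy', rfl⟩; exact hy.2 y' hy'⟩
  rw [momentValue, this.csInf_eq]

end PMIData

/-! ### Attainment, the L¹ identity and absence of a duality gap -/

theorem lemma1 {n p m na nb : ℕ} (D : PMIData n p m na nb) (hm : 0 < m) (hP : D.P.IsSymm)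
    (hUball : ∃ i R, D.a i = ballPoly p R) (hBball : ∃ j R, D.b j = ballPoly n R)
    (hU : (interior D.U).Nonempty) (hB : (interior D.B).Nonempty)
    (d₀ : ℕ) (hd₀P : 2 + D.degP ≤ 2 * d₀) (hd₀a : ∀ i, (D.a i).totalDegree ≤ 2 * d₀)
    (hd₀b : ∀ j, (D.b j).totalDegree ≤ 2 * d₀) (d : ℕ) (hd : d₀ ≤ d) :
    IntegrableOn D.robustMinEig D.B ∧
    (∀ e : SOSDegrees na nb, D.Admissible d e →
      (∃ g, D.SOSOptimal d e g) ∧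
      ∀ g, D.SOSOptimal d e g →
        D.sosValue d e = ∫ x in D.B, (D.robustMinEig x - eval x g) ∧
        D.sosValue d e = ∫ x in D.B, |D.robustMinEig x - eval x g|) ∧
    D.Admissible d (D.lowestDegrees d) ∧
    (∃ y, D.MomentOptimal d y) ∧
    D.sosValue d (D.lowestDegrees d) = D.momentValue d := by
  have hd1 : 1 ≤ d := by omega
  have hdP : 2 + D.degP ≤ 2 * d := by omega
  have hint := PMIData.integrableOn_robustMinEig hUball hBball
  have hadm : D.Admissible d (D.lowestDegrees d) := PMIData.admissible_lowestDegrees hd1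
    (fun i => (hd₀a i).trans (by omega)) (fun j => (hd₀b j).trans (by omega))
  have hUne : D.U.Nonempty := hU.mono interior_subset
  obtain ⟨g, hg⟩ := hadm.exists_SOSOptimal hm hd1 hdP hUball hBball hU hB
  obtain ⟨y, hy, hyg⟩ :=
    PMIData.exists_momentFeasible_le hm hd1 hdP hUball hBball hUne hB hadm hg
  have hyopt : D.MomentOptimal d y := ⟨hy, fun y' hy' =>
    hyg.trans (PMIData.objective_le_rieszFunctional hBball hy' hg.1)⟩
  refine ⟨hint, fun e he => ⟨he.exists_SOSOptimal hm hd1 hdP hUball hBball hU hB,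
    fun g hg => ?_⟩, hadm, ⟨y, hyopt⟩, ?_⟩
  · have h1 : D.sosValue d e = ∫ x in D.B, (D.robustMinEig x - eval x g) := by
      rw [hg.sosValue_eq]
      exact (integral_sub hint (PMIData.integrableOn_eval hBball g)).symm
    refine ⟨h1, h1.trans (setIntegral_congr_fun (PMIData.isCompact_B hBball).measurableSet
      fun x hx => ?_)⟩
    exact (abs_of_nonneg (sub_nonneg.2 (hg.1.eval_le_robustMinEig hm hUne hx))).symm
  · rw [hg.sosValue_eq, hyopt.momentValue_eq,
      le_antisymm hyg (PMIData.objective_le_rieszFunctional hBball hy hg.1)]
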